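/- Let $\gamma>0$, let $M\ge 0$ be an integer, let $b_{-M},\dots,b_M\in\mathbb C$, and let $\{a_{j,k}\}_{j,k=0}^\infty$ be an infinite complex matrix which is banded, i.e. $a_{j,j+m}=0$ whenever $|m|>M$, and which satisfies, for every integer $m$ with $|m|\le M$, $$a_{j,j+m}=b_m\,j^{-\gamma}+o(j^{-\gamma}),\qquad j\to\infty .$$ Then the matrix defines a bounded operator $A$ on $\ell^2=\ell^2(\{0,1,2,\dots\})$, this operator is compact, and its singular values satisfy $$s_n(A)=\left(\int_{-\pi}^{\pi}|b(e^{i\theta})|^{1/\gamma}\,\frac{d\theta}{2\pi}\right)^{\gamma}n^{-\gamma}+o(n^{-\gamma}),\qquad n\to\infty,$$ where $b(e^{i\theta})=\sum_{k=-M}^{M}b_k e^{ik\theta}$. Here $s_0(A)\ge s_1(A)\ge\dots$ are the eigenvalues of $|A|=\sqrt{A^*A}$, listed in non-increasing order with multiplicities (the positive ones first, continued by zeros if there are only finitely many of them). -/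

import Mathlib

open Filter Asymptotics

/-- The Hilbert space `ℓ²` of square summable complex sequences `(x_j)_{j ≥ 0}`. -/
abbrev SeqHilbert : Type := lp (fun _ : ℕ => ℂ) 2

/-- The matrix of the bounded operator `A` in the standard basis `e_0, e_1, …` of `ℓ²` is
`{a_{j,k}}`: the `j`-th coordinate of `A e_k` is `a_{j,k}`. -/
def HasMatrix (A : SeqHilbert →L[ℂ] SeqHilbert) (a : ℕ → ℕ → ℂ) : Prop :=
  ∀ j k : ℕ, A (lp.single 2 k (1 : ℂ)) j = a j k

section SingularValues

variable {H : Type*} [NormedAddCommGroup H] [InnerProductSpace ℂ H] [CompleteSpace H]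

/-- The counting function `n(t; T)`: the number of eigenvalues of `|T| = √(T* T)` that are greater
than `t`, counted with multiplicities. Eigenvectors to different eigenvalues being linearly
independent, this is the dimension of the span of the eigenspaces `ker (|T| - μ)` with `μ > t`. -/
noncomputable def singularCount (T : H →L[ℂ] H) (t : ℝ) : ℕ∞ :=
  Cardinal.toENat (Module.rank ℂ
    (⨆ μ : Set.Ioi t,
      Module.End.eigenspace ((CFC.abs T : H →L[ℂ] H) : Module.End ℂ H) ((μ : ℝ) : ℂ) :
        Submodule ℂ H))

/-- The singular value `s_n(T)` (`n = 0, 1, 2, …`) of a compact operator `T`: the `n`-th term of the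
non-increasing enumeration, with multiplicities, of the positive eigenvalues of `|T|`, continued
by zeros when these are finitely many. It is the least `t ≥ 0` such that at most `n` eigenvalues
of `|T|`, counted with multiplicities, are greater than `t`. -/
noncomputable def singularValue (T : H →L[ℂ] H) (n : ℕ) : ℝ :=
  sInf {t : ℝ | 0 ≤ t ∧ singularCount T t ≤ (n : ℕ∞)}

end SingularValues

/-- The value `b(e^{iθ}) = ∑_{k=-M}^{M} b_k e^{ikθ}` of the symbol. -/
noncomputable def bandSymbol (M : ℕ) (b : ℤ → ℂ) (θ : ℝ) : ℂ :=
  ∑ k ∈ Finset.Icc (-(M : ℤ)) (M : ℤ), b k * Complex.exp ((k : ℂ) * (θ : ℂ) * Complex.I)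

/-! ### Min-max bounds for singular values -/

section SingularValueBounds

variable {H : Type*} [NormedAddCommGroup H] [InnerProductSpace ℂ H] [CompleteSpace H]

/-! Cut the index set into blocks of length `L`. In block `r`, for large `r`, the matrix is close to
`(L r)^(-γ)` times the Laurent matrix with symbol `b`. On vectors vanishing within `M` of the block
ends, a banded matrix does not couple the blocks, and the Laurent matrix is diagonalised by the
discrete Fourier transform of length `L`, with eigenvalues `b(e^{2πip/L})`. The model therefore has
singular values `(L r)^(-γ) |b(e^{2πip/L})|`. The number of pairs `(r, p)` for which this exceeds `τ
n^(-γ)` is about `n` times the mean over `p` of `(|b| / τ)^(1/γ)`. This mean is a Riemann sum, and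
its limit is below or above 1 according as `τ` is above or below the leading coefficient `C`.

Counting becomes a statement on `s_n` through two min-max bounds, `singularValue_le_of_ker` and
`le_singularValue_of_ker`: the unwanted modes and the boundary coordinates are killed by linear
functionals, whose number is all that matters. Only about `Q n / L` blocks are relevant, so the
boundary costs about `2 M Q n / L` functionals, a small fraction of `n` once `L` is large. For the
upper bound, rows beyond `Q n` have norm a small multiple of `n^(-γ)` if `Q` is large; for the lower
bound they are discarded.

The model error is absorbed by replacing `|b|` by `|b| ± η`, which changes the mean little by
continuity. The parameters are fixed in the order `τ`, `Q` and `η`, then `L`, then the first good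
block `r₀`; finally `n → ∞`. -/

/-- The span of the eigenspaces of `|T|` to eigenvalues greater than `t`. -/
noncomputable def singularSpace (T : H →L[ℂ] H) (t : ℝ) : Submodule ℂ H :=
  ⨆ μ : Set.Ioi t,
    Module.End.eigenspace ((CFC.abs T : H →L[ℂ] H) : Module.End ℂ H) ((μ : ℝ) : ℂ)

lemma singularCount_eq (T : H →L[ℂ] H) (t : ℝ) :
    singularCount T t = Cardinal.toENat (Module.rank ℂ (singularSpace T t)) := rfl

lemma isSymmetric_abs (T : H →L[ℂ] H) :
    ((CFC.abs T : H →L[ℂ] H) : H →ₗ[ℂ] H).IsSymmetric :=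
  (IsSelfAdjoint.of_nonneg (CFC.abs_nonneg T)).isSymmetric

lemma abs_apply_abs_apply (T : H →L[ℂ] H) (x : H) :
    (CFC.abs T : H →L[ℂ] H) ((CFC.abs T : H →L[ℂ] H) x) =
      ContinuousLinearMap.adjoint T (T x) := by
  have h := CFC.abs_mul_abs T
  exact congrArg (fun S : H →L[ℂ] H => S x) h

lemma norm_abs_apply (T : H →L[ℂ] H) (x : H) : ‖(CFC.abs T : H →L[ℂ] H) x‖ = ‖T x‖ := by
  have h1 : inner ℂ ((CFC.abs T : H →L[ℂ] H) x) ((CFC.abs T : H →L[ℂ] H) x) =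
      inner ℂ (T x) (T x) := by
    have h := isSymmetric_abs T ((CFC.abs T : H →L[ℂ] H) x) x
    simp only [ContinuousLinearMap.coe_coe] at h
    rw [← h, abs_apply_abs_apply, ContinuousLinearMap.adjoint_inner_left]
  rw [inner_self_eq_norm_sq_to_K, inner_self_eq_norm_sq_to_K] at h1
  have h2 : ‖(CFC.abs T : H →L[ℂ] H) x‖ ^ 2 = ‖T x‖ ^ 2 := by exact_mod_cast h1
  exact (sq_eq_sq₀ (norm_nonneg _) (norm_nonneg _)).1 h2

/-- Eigenspaces of `|T|` are orthogonal, so by Pythagoras `‖T x‖²` is the sum of the squared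
components of `x` weighted by `μ² > t²`. Strictness survives because the sum is finite and nonempty.
-/
lemma lt_norm_of_mem_singularSpace (T : H →L[ℂ] H) {t : ℝ} (ht : 0 ≤ t) {x : H}
    (hx : x ∈ singularSpace T t) (hx0 : x ≠ 0) : t * ‖x‖ < ‖T x‖ := by
  classical
  rw [← norm_abs_apply]
  set P : H →L[ℂ] H := CFC.abs T with hP
  have horth := ((isSymmetric_abs T).orthogonalFamily_eigenspaces).comp
    (f := fun μ : Set.Ioi t => ((μ : ℝ) : ℂ))
    (fun a b h => Subtype.ext (Complex.ofReal_injective h))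
  obtain ⟨f, hf⟩ := (Submodule.mem_iSup_iff_exists_dfinsupp' _ x).1 hx
  rw [DFinsupp.sum] at hf
  have h1 : ‖x‖ ^ 2 = ∑ i ∈ f.support, ‖f i‖ ^ 2 := by
    rw [← hf]
    exact horth.norm_sum f f.support
  have hPx : P x = ∑ i ∈ f.support, ((((i : ℝ) : ℂ) • f i :
      Module.End.eigenspace (P : Module.End ℂ H) ((i : ℝ) : ℂ)) : H) := by
    rw [← hf, map_sum]
    refine Finset.sum_congr rfl fun i _ => ?_
    exact Module.End.mem_eigenspace_iff.1 (f i).2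
  have h2 : ‖P x‖ ^ 2 = ∑ i ∈ f.support, (i : ℝ) ^ 2 * ‖f i‖ ^ 2 := by
    rw [hPx]
    refine (horth.norm_sum (fun i => ((i : ℝ) : ℂ) • f i) f.support).trans ?_
    refine Finset.sum_congr rfl fun i _ => ?_
    rw [norm_smul, mul_pow, Complex.norm_real, Real.norm_eq_abs, sq_abs]
  have hne : f.support.Nonempty := by
    by_contra h
    rw [Finset.not_nonempty_iff_eq_empty] at h
    rw [h] at hf
    exact hx0 (by simpa using hf.symm)
  have h3 : (t * ‖x‖) ^ 2 < ‖P x‖ ^ 2 := by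
    rw [mul_pow, h1, h2, Finset.mul_sum]
    refine Finset.sum_lt_sum_of_nonempty hne fun i hi => ?_
    have hi0 : 0 < ‖f i‖ := norm_pos_iff.2 (DFinsupp.mem_support_iff.1 hi)
    have : t ^ 2 < (i : ℝ) ^ 2 := pow_lt_pow_left₀ i.2 ht two_ne_zero
    gcongr
  exact lt_of_pow_lt_pow_left₀ 2 (norm_nonneg _) h3

lemma singularValue_nonneg (T : H →L[ℂ] H) (n : ℕ) : 0 ≤ singularValue T n :=
  Real.sInf_nonneg fun _ ht => ht.1

/-- An operator bounded by `t` on the kernel of `n` functionals has `s_n ≤ t`. -/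
lemma singularValue_le_of_ker {ι : Type} [Fintype ι] (T : H →L[ℂ] H) (Φ : H →ₗ[ℂ] (ι → ℂ)) {t : ℝ}
    (ht : 0 ≤ t) (h : ∀ x, Φ x = 0 → ‖T x‖ ≤ t * ‖x‖) {n : ℕ} (hn : Fintype.card ι ≤ n) :
    singularValue T n ≤ t := by
  refine csInf_le ⟨0, fun s hs => hs.1⟩ ⟨ht, ?_⟩
  -- A nonzero vector of the spectral space killed by `Φ` would satisfy two contradictory bounds;
  -- hence the dimension is at most the number of functionals.
  have hinj : Function.Injective (Φ.comp (singularSpace T t).subtype) := by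
    rw [← LinearMap.ker_eq_bot, LinearMap.ker_eq_bot']
    intro x hx
    by_contra hx0
    have := lt_norm_of_mem_singularSpace T ht x.2 (by simpa using hx0)
    exact absurd (h x hx) (not_le.2 this)
  have hfin := FiniteDimensional.of_injective _ hinj
  have hle := LinearMap.finrank_le_finrank_of_injective hinj
  rw [Module.finrank_fintype_fun_eq_card] at hle
  rw [singularCount_eq, ← Module.finrank_eq_rank, map_natCast]
  exact_mod_cast hle.trans hn

/-- Factor `|T|² - ν² = (|T| + ν)(|T| - ν)`: the vector `z = (|T| - ν) v` satisfies `|T| z = -ν z`,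
which positivity of `|T|` allows only for `z = 0`. -/
lemma mem_eigenspace_abs_of_adjoint_mul_self (T : H →L[ℂ] H) {ν : ℝ} (hν : 0 < ν) {v : H}
    (hv : ContinuousLinearMap.adjoint T (T v) = ((ν ^ 2 : ℝ) : ℂ) • v) :
    v ∈ Module.End.eigenspace ((CFC.abs T : H →L[ℂ] H) : Module.End ℂ H) (ν : ℂ) := by
  rw [Module.End.mem_eigenspace_iff]
  set P : H →L[ℂ] H := CFC.abs T with hP
  set z := P v - (ν : ℂ) • v with hz
  have h1 : P z = -((ν : ℂ) • z) := by
    rw [hz, map_sub, map_smul, abs_apply_abs_apply, hv]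
    simp only [Complex.ofReal_pow]
    module
  have h2 : 0 ≤ RCLike.re (inner ℂ (P z) z) :=
    ((ContinuousLinearMap.nonneg_iff_isPositive _).1 (CFC.abs_nonneg T)).re_inner_nonneg_left z
  have h3 : RCLike.re (inner ℂ (P z) z) = -(ν * ‖z‖ ^ 2) := by
    rw [h1, inner_neg_left, inner_smul_left, inner_self_eq_norm_sq_to_K]
    simp [← Complex.ofReal_pow]
  have h4 : z = 0 := by
    by_contra h
    have : 0 < ν * ‖z‖ ^ 2 := by positivity
    linarith
  exact sub_eq_zero.1 h4

/-- This is where compactness enters. `T* T` restricts to a compact self-adjoint operator on the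
orthogonal complement. If `x ≠ 0`, its norm is at least `t²` and is attained by an eigenvalue,
necessarily of the form `‖T v‖² / ‖v‖²`. Its eigenvector `v` then belongs to `|T|` with eigenvalue
at least `t > s`, so it also lies in the spectral space, a contradiction. -/
lemma eq_zero_of_mem_orthogonal_singularSpace (T : H →L[ℂ] H) (hT : IsCompactOperator T) {s t : ℝ}
    (hs : 0 ≤ s) (hst : s < t) {x : H} (hx : x ∈ (singularSpace T s)ᗮ)
    (hxt : t * ‖x‖ ≤ ‖T x‖) : x = 0 := by
  by_contra hx0
  set E := singularSpace T s with hE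
  set S : H →L[ℂ] H := ContinuousLinearMap.adjoint T ∘L T with hS
  have hSc : IsCompactOperator S := hT.clm_comp (ContinuousLinearMap.adjoint T)
  have hEinv : ∀ y ∈ E, S y ∈ E := by
    intro y hy
    refine Submodule.iSup_induction (motive := fun y => S y ∈ E) _ hy ?_ ?_ ?_
    · intro i y hy
      have hPy := Module.End.mem_eigenspace_iff.1 hy
      simp only [ContinuousLinearMap.coe_coe] at hPy
      have : S y = ((i : ℝ) : ℂ) • ((i : ℝ) : ℂ) • y := by
        rw [← hPy, ← map_smul, ← hPy, abs_apply_abs_apply]; rfl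
      rw [this]
      exact E.smul_mem _ (E.smul_mem _ (Submodule.mem_iSup_of_mem i hy))
    · simp
    · intro y z hy hz
      rw [map_add]; exact E.add_mem hy hz
  have hsymm : (S : H →ₗ[ℂ] H).IsSymmetric := by
    intro y z
    simp [hS, ContinuousLinearMap.adjoint_inner_left, ContinuousLinearMap.adjoint_inner_right]
  have hinv : ∀ y ∈ Eᗮ, (S : H →ₗ[ℂ] H) y ∈ Eᗮ := by
    intro y hy
    rw [Submodule.mem_orthogonal] at hy ⊢
    intro u hu
    rw [← hsymm]
    exact hy _ (hEinv u hu)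
  let R : Eᗮ →L[ℂ] Eᗮ := S.restrict hinv
  have hRc : IsCompactOperator R := hSc.restrict' hinv
  have hRs : (R : Eᗮ →ₗ[ℂ] Eᗮ).IsSymmetric := hsymm.restrict_invariant hinv
  let x' : Eᗮ := ⟨x, hx⟩
  have hxn : 0 < ‖x‖ := norm_pos_iff.2 hx0
  have hRn : t ^ 2 ≤ ‖R‖ := by
    have h1 : ‖T x‖ ^ 2 ≤ ‖R‖ * ‖x‖ ^ 2 := by
      have h2 : RCLike.re (inner ℂ (R x') x') = ‖T x‖ ^ 2 := by
        have : inner ℂ (R x') x' = inner ℂ (S x) x := rfl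
        rw [this, hS, ContinuousLinearMap.comp_apply, ContinuousLinearMap.adjoint_inner_left,
          inner_self_eq_norm_sq]
      calc ‖T x‖ ^ 2 = RCLike.re (inner ℂ (R x') x') := h2.symm
        _ ≤ ‖R x'‖ * ‖x'‖ := re_inner_le_norm _ _
        _ ≤ ‖R‖ * ‖x'‖ * ‖x'‖ := by gcongr; exact R.le_opNorm x'
        _ = ‖R‖ * ‖x‖ ^ 2 := by rw [mul_assoc, ← sq]; rfl
    have h3 : (t * ‖x‖) ^ 2 ≤ ‖T x‖ ^ 2 :=
      pow_le_pow_left₀ (by have := hs.trans hst.le; positivity) hxt 2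
    rw [mul_pow] at h3
    exact le_of_mul_le_mul_right (h3.trans h1) (by positivity)
  have ht2 : 0 < t ^ 2 := by have := hs.trans_lt hst; positivity
  have hnt : Nontrivial Eᗮ := ⟨x', 0, fun h => hx0 (congrArg Subtype.val h)⟩
  obtain ⟨μ, hμ, hμn⟩ := spectrum.exists_nnnorm_eq_spectralRadius R
  rw [R.spectralRadius_eq_nnnorm hRs.isSelfAdjoint, ENNReal.coe_inj] at hμn
  have hμn' : ‖μ‖ = ‖R‖ := congrArg NNReal.toReal hμn
  have hμ0 : μ ≠ 0 := by
    rintro rfl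
    rw [norm_zero] at hμn'
    linarith
  have hev := (hRc.hasEigenvalue_iff_mem_spectrum hμ0).2 hμ
  obtain ⟨v, hv⟩ := hev.exists_hasEigenvector
  have hv1 : S (v : H) = μ • (v : H) := congrArg Subtype.val hv.apply_eq_smul
  have hv0 : (v : H) ≠ 0 := fun h => hv.2 (Subtype.ext h)
  have hvn : 0 < ‖(v : H)‖ := norm_pos_iff.2 hv0
  have hμr : μ = ((‖T v‖ ^ 2 / ‖(v : H)‖ ^ 2 : ℝ) : ℂ) := by
    have h1 : inner ℂ (v : H) (S v) = ((‖T v‖ ^ 2 : ℝ) : ℂ) := by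
      rw [hS, ContinuousLinearMap.comp_apply, ContinuousLinearMap.adjoint_inner_right,
        inner_self_eq_norm_sq_to_K]
      norm_cast
    rw [hv1, inner_smul_right, inner_self_eq_norm_sq_to_K] at h1
    rw [Complex.ofReal_div, eq_div_iff (by exact_mod_cast (pow_pos hvn 2).ne')]
    push_cast at h1 ⊢
    exact h1
  set q := ‖T v‖ ^ 2 / ‖(v : H)‖ ^ 2 with hq
  have hq0 : 0 ≤ q := by positivity
  have hqt : t ^ 2 ≤ q := by
    rw [hμr, Complex.norm_real, Real.norm_of_nonneg hq0] at hμn'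
    rw [hμn']; exact hRn
  have hsq : s < √q := by
    refine hst.trans_le (Real.le_sqrt_of_sq_le hqt)
  have hvE : (v : H) ∈ E := by
    refine Submodule.mem_iSup_of_mem (⟨√q, hsq⟩ : Set.Ioi s) ?_
    refine mem_eigenspace_abs_of_adjoint_mul_self T (hs.trans_lt hsq) ?_
    rw [Real.sq_sqrt hq0, ← hμr]
    exact hv1
  have := Submodule.inner_right_of_mem_orthogonal hvE v.2
  exact hv0 (inner_self_eq_zero.1 this)

/-- A compact operator bounded below by `t` on a subspace of dimension greater than `n`, given as
the intersection of an `N`-dimensional space with the kernel of fewer than `N - n` functionals,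
has `s_n ≥ t`. -/
lemma le_singularValue_of_ker {ι : Type} [Fintype ι] (T : H →L[ℂ] H) (hT : IsCompactOperator T)
    {N n : ℕ} (Ψ : (Fin N → ℂ) →ₗ[ℂ] H) (hΨ : Function.Injective Ψ) (Φ : H →ₗ[ℂ] (ι → ℂ)) {t : ℝ}
    (h : ∀ c, Φ (Ψ c) = 0 → t * ‖Ψ c‖ ≤ ‖T (Ψ c)‖) (hn : n + Fintype.card ι < N) :
    t ≤ singularValue T n := by
  -- The set defining `s_n` must be nonempty for its infimum to be meaningful; `‖T‖` belongs to it,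
  -- as no eigenvalue exceeds the norm.
  refine le_csInf ⟨‖T‖, norm_nonneg _, ?_⟩ ?_
  · have : singularSpace T ‖T‖ = ⊥ := by
      rw [eq_bot_iff]
      intro x hx
      by_contra hx0
      exact absurd (T.le_opNorm x)
        (not_le.2 (lt_norm_of_mem_singularSpace T (norm_nonneg _) hx (by simpa using hx0)))
    rw [singularCount_eq, this]
    simp
  · rintro s ⟨hs, hcount⟩
    by_contra! hst
    rw [singularCount_eq] at hcount
    have hrank : Module.rank ℂ (singularSpace T s) ≤ n := by
      rwa [Cardinal.toENat_le_natCast] at hcount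
    have hfin : FiniteDimensional ℂ (singularSpace T s) :=
      Module.rank_lt_aleph0_iff.1 (hrank.trans_lt (Cardinal.natCast_lt_aleph0))
    have hfr : Module.finrank ℂ (singularSpace T s) ≤ n := by
      rw [← Module.finrank_eq_rank] at hrank
      exact_mod_cast hrank
    -- The source has dimension greater than the number of functionals plus `n`, so some nonzero
    -- vector is killed by `Φ` and orthogonal to the spectral space.
    let G : (Fin N → ℂ) →ₗ[ℂ] (ι → ℂ) × singularSpace T s :=
      (Φ.comp Ψ).prod
        (((singularSpace T s).orthogonalProjectionOnto : H →ₗ[ℂ] singularSpace T s).comp Ψ)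
    have hker : LinearMap.ker G ≠ ⊥ := by
      refine LinearMap.ker_ne_bot_of_finrank_lt ?_
      rw [Module.finrank_prod, Module.finrank_fintype_fun_eq_card, Module.finrank_fintype_fun_eq_card,
        Fintype.card_fin]
      omega
    obtain ⟨c, hc, hc0⟩ := Submodule.exists_mem_ne_zero_of_ne_bot hker
    have hc' : Φ (Ψ c) = 0 ∧ (singularSpace T s).orthogonalProjectionOnto (Ψ c) = 0 := by
      simpa [G, LinearMap.mem_ker, Prod.ext_iff] using hc
    have horth : Ψ c ∈ (singularSpace T s)ᗮ := by
      simpa using hc'.2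
    have := eq_zero_of_mem_orthogonal_singularSpace T hT hs hst horth (h c hc'.1)
    exact hc0 (hΨ (by rw [this, map_zero]))

end SingularValueBounds

/-! ### Norms in `ℓ²` through finite sums -/

section SequenceSpace

lemma seqHilbert_sum_norm_sq_le (x : SeqHilbert) (s : Finset ℕ) :
    ∑ j ∈ s, ‖x j‖ ^ 2 ≤ ‖x‖ ^ 2 := by
  have := lp.sum_rpow_le_norm_rpow (p := 2) (by norm_num) x s
  simpa using this

lemma seqHilbert_norm_sq_eq_tsum (x : SeqHilbert) : ‖x‖ ^ 2 = ∑' j, ‖x j‖ ^ 2 := by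
  have := lp.norm_rpow_eq_tsum (p := 2) (by norm_num) x
  simpa using this

lemma seqHilbert_norm_le {x : SeqHilbert} {C : ℝ} (hC : 0 ≤ C)
    (h : ∀ s : Finset ℕ, ∑ j ∈ s, ‖x j‖ ^ 2 ≤ C ^ 2) : ‖x‖ ≤ C :=
  lp.norm_le_of_forall_sum_le (p := 2) (by norm_num) hC (by simpa using h)

end SequenceSpace

/-! ### Boundedness and compactness of banded matrices -/

section BandedOperators

/-- The row sums `∑_k a_{j,k} x_k` of a banded matrix. -/
def bandRow (M : ℕ) (a : ℕ → ℕ → ℂ) (x : ℕ → ℂ) (j : ℕ) : ℂ :=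
  ∑ k ∈ Finset.Icc (j - M) (j + M), a j k * x k

variable {M : ℕ} {a : ℕ → ℕ → ℂ}

/-- Each index `k` lies in at most `2 M + 1` of the windows. -/
lemma sum_sum_band_le (M : ℕ) {g : ℕ → ℝ} (hg : ∀ k, 0 ≤ g k) (s : Finset ℕ) :
    ∑ j ∈ s, ∑ k ∈ Finset.Icc (j - M) (j + M), g k ≤
      (2 * M + 1) * ∑ k ∈ s.biUnion fun j => Finset.Icc (j - M) (j + M), g k := by
  rw [Finset.sum_comm' (t' := s.biUnion fun j => Finset.Icc (j - M) (j + M))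
    (s' := fun k => s.filter fun j => k ∈ Finset.Icc (j - M) (j + M))]
  · rw [Finset.mul_sum]
    refine Finset.sum_le_sum fun k _ => ?_
    rw [Finset.sum_const, nsmul_eq_mul]
    refine mul_le_mul_of_nonneg_right ?_ (hg k)
    have h1 : (s.filter fun j => k ∈ Finset.Icc (j - M) (j + M)) ⊆ Finset.Icc (k - M) (k + M) := by
      intro j hj
      simp only [Finset.mem_filter, Finset.mem_Icc] at hj ⊢
      omega
    have h2 := Finset.card_le_card h1
    rw [Nat.card_Icc] at h2
    have h3 : (s.filter fun j => k ∈ Finset.Icc (j - M) (j + M)).card ≤ 2 * M + 1 := by omega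
    exact_mod_cast h3
  · intro j k
    simp only [Finset.mem_filter, Finset.mem_biUnion]
    constructor
    · rintro ⟨h1, h2⟩
      exact ⟨⟨h1, h2⟩, j, h1, h2⟩
    · rintro ⟨h1, _⟩
      exact h1

/-- Cauchy-Schwarz in each row gives one factor `2 M + 1`, the overlap of the windows the other.
Only the rows in `s` need small entries, so the bound serves both for boundedness and for tails. -/
lemma sum_norm_bandRow_sq_le (x : SeqHilbert) (s : Finset ℕ) {c : ℝ}
    (h : ∀ j ∈ s, ∀ k, ‖a j k‖ ≤ c) :
    ∑ j ∈ s, ‖bandRow M a x j‖ ^ 2 ≤ (c * (2 * M + 1) * ‖x‖) ^ 2 := by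
  have hrow : ∀ j ∈ s, ‖bandRow M a x j‖ ^ 2 ≤
      c ^ 2 * (2 * M + 1) * ∑ k ∈ Finset.Icc (j - M) (j + M), ‖x k‖ ^ 2 := by
    intro j hj
    have h1 : ‖bandRow M a x j‖ ≤ c * ∑ k ∈ Finset.Icc (j - M) (j + M), ‖x k‖ := by
      rw [Finset.mul_sum]
      refine (norm_sum_le _ _).trans (Finset.sum_le_sum fun k _ => ?_)
      rw [norm_mul]
      exact mul_le_mul_of_nonneg_right (h j hj k) (norm_nonneg _)
    have h2 : (∑ k ∈ Finset.Icc (j - M) (j + M), ‖x k‖) ^ 2 ≤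
        (2 * M + 1) * ∑ k ∈ Finset.Icc (j - M) (j + M), ‖x k‖ ^ 2 := by
      refine sq_sum_le_card_mul_sum_sq.trans ?_
      refine mul_le_mul_of_nonneg_right ?_ (Finset.sum_nonneg fun _ _ => by positivity)
      have : (Finset.Icc (j - M) (j + M)).card ≤ 2 * M + 1 := by rw [Nat.card_Icc]; omega
      exact_mod_cast this
    calc ‖bandRow M a x j‖ ^ 2 ≤ (c * ∑ k ∈ Finset.Icc (j - M) (j + M), ‖x k‖) ^ 2 :=
          pow_le_pow_left₀ (norm_nonneg _) h1 2
      _ ≤ c ^ 2 * ((2 * M + 1) * ∑ k ∈ Finset.Icc (j - M) (j + M), ‖x k‖ ^ 2) := by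
          rw [mul_pow]; exact mul_le_mul_of_nonneg_left h2 (sq_nonneg c)
      _ = _ := by ring
  refine (Finset.sum_le_sum hrow).trans ?_
  rw [← Finset.mul_sum]
  have h3 := sum_sum_band_le M (g := fun k => ‖x k‖ ^ 2) (fun k => by positivity) s
  have h4 := seqHilbert_sum_norm_sq_le x (s.biUnion fun j => Finset.Icc (j - M) (j + M))
  calc c ^ 2 * (2 * M + 1) * ∑ j ∈ s, ∑ k ∈ Finset.Icc (j - M) (j + M), ‖x k‖ ^ 2
      ≤ c ^ 2 * (2 * M + 1) * ((2 * M + 1) * ‖x‖ ^ 2) := by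
        gcongr
        exact h3.trans (by gcongr)
    _ = _ := by ring

lemma exists_hasMatrix_of_banded
    (hband : ∀ j k : ℕ, (M : ℤ) < |(k : ℤ) - (j : ℤ)| → a j k = 0) {c : ℝ}
    (hc : ∀ j k, ‖a j k‖ ≤ c) : ∃ A : SeqHilbert →L[ℂ] SeqHilbert, HasMatrix A a := by
  have hc0 : 0 ≤ c := (norm_nonneg _).trans (hc 0 0)
  have hmem : ∀ x : SeqHilbert, Memℓp (bandRow M a x) 2 := fun x =>
    memℓp_gen' (C := (c * (2 * M + 1) * ‖x‖) ^ 2) fun s => by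
      simpa using sum_norm_bandRow_sq_le (M := M) x s fun j _ k => hc j k
  let A₀ : SeqHilbert →ₗ[ℂ] SeqHilbert :=
    { toFun := fun x => ⟨bandRow M a x, hmem x⟩
      map_add' := fun x y => by
        ext j
        change bandRow M a (x + y : SeqHilbert) j = bandRow M a x j + bandRow M a y j
        simp [bandRow, mul_add, Finset.sum_add_distrib]
      map_smul' := fun r x => by
        ext j
        simp only [bandRow, lp.coeFn_smul, Pi.smul_apply, smul_eq_mul, RingHom.id_apply,
          Finset.mul_sum]
        exact Finset.sum_congr rfl fun _ _ => by ring }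
  refine ⟨A₀.mkContinuous (c * (2 * M + 1)) fun x => ?_, fun j k => ?_⟩
  · exact seqHilbert_norm_le (by positivity) fun s =>
      sum_norm_bandRow_sq_le (M := M) x s fun j _ k => hc j k
  · change bandRow M a (lp.single 2 k (1 : ℂ) : SeqHilbert) j = a j k
    simp only [bandRow, lp.coeFn_single, Pi.single_apply, mul_ite, mul_one, mul_zero,
      Finset.sum_ite_eq', Finset.mem_Icc]
    split_ifs with h
    · rfl
    · exact (hband j k (by rw [lt_abs]; omega)).symm

variable {A : SeqHilbert →L[ℂ] SeqHilbert}

/-- By continuity `A` may be applied termwise to the expansion of `x` in the standard basis. -/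
lemma HasMatrix.apply_eq_bandRow (hA : HasMatrix A a)
    (hband : ∀ j k : ℕ, (M : ℤ) < |(k : ℤ) - (j : ℤ)| → a j k = 0) (x : SeqHilbert) (j : ℕ) :
    A x j = bandRow M a x j := by
  have h1 := lp.hasSum_single (p := 2) (by norm_num) x
  have h2 := h1.mapL ((lp.evalCLM ℂ (fun _ : ℕ => ℂ) 2 j).comp A)
  have h3 : ∀ k, ((lp.evalCLM ℂ (fun _ : ℕ => ℂ) 2 j).comp A) (lp.single 2 k (x k)) =
      a j k * x k := by
    intro k
    have : (lp.single 2 k (x k) : SeqHilbert) = x k • lp.single 2 k (1 : ℂ) := by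
      rw [← lp.single_smul]; simp
    rw [this, map_smul, smul_eq_mul, mul_comm, ← hA j k]
    rfl
  simp only [h3] at h2
  refine h2.unique (hasSum_sum_of_ne_finset_zero fun k hk => ?_)
  rw [hband j k, zero_mul]
  rw [Finset.mem_Icc] at hk
  rw [lt_abs]
  omega

lemma HasMatrix.norm_apply_sq_le (hA : HasMatrix A a)
    (hband : ∀ j k : ℕ, (M : ℤ) < |(k : ℤ) - (j : ℤ)| → a j k = 0) {N : ℕ} {c : ℝ}
    (hc : ∀ j k, N ≤ j → ‖a j k‖ ≤ c) (x : SeqHilbert) :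
    ‖A x‖ ^ 2 ≤ ∑ j ∈ Finset.range N, ‖A x j‖ ^ 2 + (c * (2 * M + 1) * ‖x‖) ^ 2 := by
  rw [seqHilbert_norm_sq_eq_tsum]
  refine Real.tsum_le_of_sum_le (fun _ => by positivity) fun s => ?_
  rw [← Finset.sum_filter_add_sum_filter_not s (· < N)]
  refine add_le_add ?_ ?_
  · refine Finset.sum_le_sum_of_subset_of_nonneg (fun j hj => ?_) fun _ _ _ => by positivity
    exact Finset.mem_range.2 (Finset.mem_filter.1 hj).2
  · simp only [hA.apply_eq_bandRow hband]
    refine sum_norm_bandRow_sq_le x _ fun j hj k => hc j k ?_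
    exact not_lt.1 (Finset.mem_filter.1 hj).2

/-- The truncations `F N` to the first `N` rows have finite rank and converge to `A` in norm, since
the remaining rows have uniformly small entries. -/
lemma HasMatrix.isCompactOperator (hA : HasMatrix A a)
    (hband : ∀ j k : ℕ, (M : ℤ) < |(k : ℤ) - (j : ℤ)| → a j k = 0)
    (ha : ∀ c : ℝ, 0 < c → ∃ N : ℕ, ∀ j k, N ≤ j → ‖a j k‖ ≤ c) : IsCompactOperator A := by
  let F : ℕ → SeqHilbert →L[ℂ] SeqHilbert := fun N => ∑ j ∈ Finset.range N,
    (lp.singleContinuousLinearMap ℂ (fun _ : ℕ => ℂ) 2 j).comp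
      ((lp.evalCLM ℂ (fun _ : ℕ => ℂ) 2 j).comp A)
  have hF : ∀ N x i, F N x i = if i < N then A x i else 0 := by
    intro N x i
    simp only [F, sum_apply, lp.coeFn_sum, Finset.sum_apply,
      ContinuousLinearMap.comp_apply, lp.singleContinuousLinearMap_apply, lp.coeFn_single]
    change ∑ j ∈ Finset.range N, (Pi.single j (A x j) : ℕ → ℂ) i = _
    simp [Pi.single_apply]
  refine isCompactOperator_of_tendsto (F := F) (l := atTop) ?_ (Eventually.of_forall fun N => ?_)
  · rw [Metric.tendsto_atTop]
    intro ε hε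
    obtain ⟨N, hN⟩ := ha (ε / 2 / (2 * M + 1)) (by positivity)
    refine ⟨N, fun n hn => ?_⟩
    rw [dist_comm, dist_eq_norm]
    refine lt_of_le_of_lt (ContinuousLinearMap.opNorm_le_bound _ (half_pos hε).le fun x => ?_)
      (half_lt_self hε)
    refine seqHilbert_norm_le (by positivity) fun s => ?_
    have h1 : ∀ j, ‖(A - F n) x j‖ ^ 2 = if j < n then 0 else ‖bandRow M a x j‖ ^ 2 := by
      intro j
      rw [← hA.apply_eq_bandRow hband, sub_apply, lp.coeFn_sub, Pi.sub_apply, hF]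
      split_ifs <;> simp
    simp only [h1]
    rw [Finset.sum_ite, Finset.sum_const_zero, zero_add]
    refine (sum_norm_bandRow_sq_le x _ fun j hj k =>
      hN j k (hn.trans (not_lt.1 (Finset.mem_filter.1 hj).2))).trans (le_of_eq ?_)
    field_simp
  · refine Submodule.sum_mem (compactOperator (RingHom.id ℂ) SeqHilbert SeqHilbert) fun j _ => ?_
    exact (isCompactOperator_of_locallyCompactSpace_rng
      (lp.singleContinuousLinearMap ℂ (fun _ : ℕ => ℂ) 2 j)).comp_clm _

end BandedOperators

/-! ### Fourier analysis on one block -/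

section BlockFourier

/-- The `p`-th frequency `2πp/L` of the discrete Fourier transform of length `L`. -/
noncomputable def blockFreq (L p : ℕ) : ℝ := 2 * Real.pi * p / L

/-- The discrete Fourier transform of length `L`. -/
noncomputable def blockDFT (L : ℕ) (u : ℕ → ℂ) (p : ℕ) : ℂ :=
  ∑ i ∈ Finset.range L, u i * Complex.exp (-(i * (blockFreq L p : ℂ) * Complex.I))

/-- The Euclidean norm of the first `L` terms of a sequence. -/
noncomputable def blockNorm (L : ℕ) (u : ℕ → ℂ) : ℝ :=
  ‖(WithLp.toLp 2 fun i : Fin L => u i : EuclideanSpace ℂ (Fin L))‖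

/-- The entries of the banded Laurent matrix with symbol `b`. -/
def bandCoeff (M : ℕ) (b : ℤ → ℂ) (m : ℤ) : ℂ := if |m| ≤ (M : ℤ) then b m else 0

variable {L M : ℕ}

lemma blockNorm_nonneg (u : ℕ → ℂ) : 0 ≤ blockNorm L u := norm_nonneg _

lemma blockNorm_sq (u : ℕ → ℂ) : blockNorm L u ^ 2 = ∑ i ∈ Finset.range L, ‖u i‖ ^ 2 := by
  rw [blockNorm, EuclideanSpace.norm_sq_eq, Finset.sum_range]

lemma blockNorm_le_add (f g : ℕ → ℂ) : blockNorm L f ≤ blockNorm L g + blockNorm L (f - g) := by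
  unfold blockNorm
  have : (WithLp.toLp 2 fun i : Fin L => f i : EuclideanSpace ℂ (Fin L)) =
      WithLp.toLp 2 (fun i : Fin L => g i) + WithLp.toLp 2 (fun i : Fin L => (f - g) i) := by
    ext i; simp
  rw [this]
  exact norm_add_le _ _

lemma blockNorm_smul {w : ℝ} (hw : 0 ≤ w) (f : ℕ → ℂ) :
    blockNorm L (fun i => (w : ℂ) * f i) = w * blockNorm L f := by
  unfold blockNorm
  have : (WithLp.toLp 2 fun i : Fin L => (w : ℂ) * f i : EuclideanSpace ℂ (Fin L)) =
      (w : ℂ) • WithLp.toLp 2 (fun i : Fin L => f i) := by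
    ext i; simp
  rw [this, norm_smul, Complex.norm_real, Real.norm_of_nonneg hw]

lemma blockNorm_sub_comm (f g : ℕ → ℂ) : blockNorm L (f - g) = blockNorm L (g - f) := by
  rw [← sq_eq_sq₀ (blockNorm_nonneg _) (blockNorm_nonneg _), blockNorm_sq, blockNorm_sq]
  simp [norm_sub_rev]

/-- A geometric sum whose ratio is an `L`-th root of unity, different from 1 because `L` does not
divide `k`. -/
lemma sum_exp_blockFreq_eq_zero {k : ℤ} (hk : k ≠ 0) (hkL : |k| < L) :
    ∑ p ∈ Finset.range L, Complex.exp (k * (blockFreq L p : ℂ) * Complex.I) = 0 := by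
  have hL : (L : ℂ) ≠ 0 := by
    have : 0 < L := by have := abs_nonneg k; omega
    exact_mod_cast this.ne'
  set z : ℂ := Complex.exp (k * (2 * Real.pi / L) * Complex.I) with hz
  have h1 : ∀ p : ℕ, Complex.exp (k * (blockFreq L p : ℂ) * Complex.I) = z ^ p := by
    intro p
    rw [hz, ← Complex.exp_nat_mul, blockFreq]
    congr 1
    push_cast
    ring
  simp only [h1]
  have hzL : z ^ L = 1 := by
    rw [hz, ← Complex.exp_nat_mul, Complex.exp_eq_one_iff]
    exact ⟨k, by field_simp⟩
  have hz1 : z ≠ 1 := by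
    intro h
    rw [hz, Complex.exp_eq_one_iff] at h
    obtain ⟨n, hn⟩ := h
    have hpi : (2 * Real.pi * Complex.I : ℂ) ≠ 0 := Complex.two_pi_I_ne_zero
    have h2 : (k : ℂ) = n * L := by
      have h3 : (k : ℂ) * (2 * Real.pi * Complex.I) = n * L * (2 * Real.pi * Complex.I) := by
        have := congrArg (· * (L : ℂ)) hn
        field_simp at this
        linear_combination (2 * Real.pi * Complex.I) * this
      exact mul_right_cancel₀ hpi h3
    have h3 : k = n * L := by exact_mod_cast h2
    have hn0 : n ≠ 0 := by rintro rfl; simp at h3; exact hk h3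
    rw [h3, abs_mul, Nat.abs_cast] at hkL
    have : 1 ≤ |n| := Int.one_le_abs hn0
    nlinarith [Int.natCast_nonneg L]
  have := mul_neg_geom_sum z L
  rw [hzL, sub_self] at this
  exact (mul_eq_zero.1 this).resolve_left (sub_ne_zero.2 hz1.symm)

lemma conj_exp_neg_mul_I (i : ℕ) (θ : ℝ) :
    (starRingEnd ℂ) (Complex.exp (-(i * (θ : ℂ) * Complex.I))) =
      Complex.exp (i * (θ : ℂ) * Complex.I) := by
  rw [← Complex.exp_conj]
  simp

/-- Parseval's identity for the discrete Fourier transform. -/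
lemma sum_norm_blockDFT_sq (u : ℕ → ℂ) :
    ∑ p ∈ Finset.range L, ‖blockDFT L u p‖ ^ 2 = L * blockNorm L u ^ 2 := by
  rw [blockNorm_sq]
  have h : ((∑ p ∈ Finset.range L, ‖blockDFT L u p‖ ^ 2 : ℝ) : ℂ) =
      ((L * ∑ i ∈ Finset.range L, ‖u i‖ ^ 2 : ℝ) : ℂ) := by
    push_cast
    simp only [← Complex.mul_conj']
    have h1 : ∀ p, blockDFT L u p * (starRingEnd ℂ) (blockDFT L u p) =
        ∑ i ∈ Finset.range L, ∑ k ∈ Finset.range L, u i * (starRingEnd ℂ) (u k) *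
          Complex.exp (((k : ℤ) - (i : ℤ) : ℤ) * (blockFreq L p : ℂ) * Complex.I) := by
      intro p
      rw [blockDFT, map_sum, Finset.sum_mul_sum]
      refine Finset.sum_congr rfl fun i _ => Finset.sum_congr rfl fun k _ => ?_
      have : Complex.exp (((k : ℤ) - (i : ℤ) : ℤ) * (blockFreq L p : ℂ) * Complex.I) =
          Complex.exp (-(i * (blockFreq L p : ℂ) * Complex.I)) *
            Complex.exp (k * (blockFreq L p : ℂ) * Complex.I) := by
        rw [← Complex.exp_add]
        congr 1
        push_cast
        ring
      rw [map_mul, conj_exp_neg_mul_I, this]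
      ring
    simp only [h1]
    rw [Finset.sum_comm, Finset.mul_sum]
    refine Finset.sum_congr rfl fun i hi => ?_
    rw [Finset.sum_comm, Finset.sum_eq_single i]
    · simp
    · intro k hk hki
      rw [← Finset.mul_sum, sum_exp_blockFreq_eq_zero, mul_zero]
      · omega
      · rw [Finset.mem_range] at hi hk
        rw [abs_lt]
        omega
    · intro h; exact absurd hi h
  exact_mod_cast h

/-- At distance `M` from the ends, column `k` of the Laurent matrix lies entirely within the block,
so substituting `m = k - i` recovers the full symbol. -/
lemma sum_bandCoeff_mul_exp (b : ℤ → ℂ) (θ : ℝ) {k : ℕ} (h1 : M ≤ k) (h2 : k + M < L) :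
    ∑ i ∈ Finset.range L, bandCoeff M b ((k : ℤ) - i) * Complex.exp (-(i * (θ : ℂ) * Complex.I)) =
      bandSymbol M b θ * Complex.exp (-(k * (θ : ℂ) * Complex.I)) := by
  rw [bandSymbol, Finset.sum_mul]
  simp only [bandCoeff, ite_mul, zero_mul]
  rw [← Finset.sum_filter]
  refine Finset.sum_nbij' (fun i => (k : ℤ) - i) (fun m => ((k : ℤ) - m).toNat) ?_ ?_ ?_ ?_ ?_
  · intro i hi
    simp only [Finset.mem_filter, Finset.mem_range, abs_le, Finset.mem_Icc] at hi ⊢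
    exact hi.2
  · intro m hm
    simp only [Finset.mem_filter, Finset.mem_range, abs_le, Finset.mem_Icc] at hm ⊢
    omega
  · intro i hi
    omega
  · intro m hm
    simp only [Finset.mem_Icc] at hm
    omega
  · intro i hi
    rw [mul_assoc (b _), ← Complex.exp_add]
    congr 2
    push_cast
    ring

/-- On sequences vanishing near the ends of the block the Laurent matrix is diagonalised by the
discrete Fourier transform. -/
lemma blockDFT_laurent (b : ℤ → ℂ) {u : ℕ → ℂ}
    (hu : ∀ i < L, (i < M ∨ L ≤ i + M) → u i = 0) (p : ℕ) :
    blockDFT L (fun i => ∑ k ∈ Finset.range L, bandCoeff M b ((k : ℤ) - i) * u k) p =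
      bandSymbol M b (blockFreq L p) * blockDFT L u p := by
  simp only [blockDFT, Finset.sum_mul]
  rw [Finset.sum_comm, Finset.mul_sum]
  refine Finset.sum_congr rfl fun k hk => ?_
  by_cases hk' : k < M ∨ L ≤ k + M
  · simp [hu k (Finset.mem_range.1 hk) hk']
  · rw [not_or, not_lt, not_le] at hk'
    have := sum_bandCoeff_mul_exp b (blockFreq L p) hk'.1 hk'.2
    calc _ = u k * ∑ i ∈ Finset.range L, bandCoeff M b ((k : ℤ) - i) *
          Complex.exp (-(i * (blockFreq L p : ℂ) * Complex.I)) := by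
          rw [Finset.mul_sum]
          exact Finset.sum_congr rfl fun _ _ => by ring
      _ = _ := by rw [this]; ring

/-- A Hilbert-Schmidt type bound. The factor `L` is harmless, as the entrywise error is chosen after
`L`. -/
lemma blockNorm_sub_le {α β : ℕ → ℕ → ℂ} {u : ℕ → ℂ} {c : ℝ}
    (h : ∀ i < L, ∀ k < L, ‖α i k - β i k‖ ≤ c) :
    blockNorm L ((fun i => ∑ k ∈ Finset.range L, α i k * u k) -
      fun i => ∑ k ∈ Finset.range L, β i k * u k) ≤ c * L * blockNorm L u := by
  rcases Nat.eq_zero_or_pos L with rfl | hL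
  · simp [blockNorm, Matrix.empty_eq]
  have hc : 0 ≤ c := (norm_nonneg _).trans (h 0 hL 0 hL)
  refine le_of_sq_le_sq ?_ (by have := blockNorm_nonneg (L := L) u; positivity)
  rw [mul_pow, blockNorm_sq, blockNorm_sq]
  have h1 : ∀ i ∈ Finset.range L, ‖((fun i => ∑ k ∈ Finset.range L, α i k * u k) -
      fun i => ∑ k ∈ Finset.range L, β i k * u k) i‖ ^ 2 ≤
      c ^ 2 * (L * ∑ k ∈ Finset.range L, ‖u k‖ ^ 2) := by
    intro i hi
    have h2 : ‖((fun i => ∑ k ∈ Finset.range L, α i k * u k) -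
      fun i => ∑ k ∈ Finset.range L, β i k * u k) i‖ ≤ c * ∑ k ∈ Finset.range L, ‖u k‖ := by
      rw [Pi.sub_apply, ← Finset.sum_sub_distrib, Finset.mul_sum]
      refine (norm_sum_le _ _).trans (Finset.sum_le_sum fun k hk => ?_)
      rw [← sub_mul, norm_mul]
      exact mul_le_mul_of_nonneg_right
        (h i (Finset.mem_range.1 hi) k (Finset.mem_range.1 hk)) (norm_nonneg _)
    refine (pow_le_pow_left₀ (norm_nonneg _) h2 2).trans ?_
    rw [mul_pow]
    refine mul_le_mul_of_nonneg_left ?_ (sq_nonneg c)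
    simpa using sq_sum_le_card_mul_sum_sq (s := Finset.range L) (f := fun k => ‖u k‖)
  refine (Finset.sum_le_sum h1).trans (le_of_eq ?_)
  rw [Finset.sum_const, Finset.card_range, nsmul_eq_mul]
  ring

variable {b : ℤ → ℂ} {u : ℕ → ℂ} {α : ℕ → ℕ → ℂ} {w δ η t : ℝ}

lemma blockNorm_laurent_sq (hu : ∀ i < L, (i < M ∨ L ≤ i + M) → u i = 0) :
    L * blockNorm L (fun i => ∑ k ∈ Finset.range L, bandCoeff M b ((k : ℤ) - i) * u k) ^ 2 =
      ∑ p ∈ Finset.range L, ‖bandSymbol M b (blockFreq L p)‖ ^ 2 * ‖blockDFT L u p‖ ^ 2 := by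
  rw [← sum_norm_blockDFT_sq]
  refine Finset.sum_congr rfl fun p _ => ?_
  rw [blockDFT_laurent b hu, norm_mul, mul_pow]

lemma blockNorm_sub_laurent_le (hw : 0 ≤ w) (hδ : δ * L ≤ η)
    (hα : ∀ i < L, ∀ k < L, ‖α i k - w * bandCoeff M b ((k : ℤ) - i)‖ ≤ δ * w) :
    blockNorm L ((fun i => ∑ k ∈ Finset.range L, α i k * u k) -
      fun i : ℕ => (w : ℂ) * ∑ k ∈ Finset.range L, bandCoeff M b ((k : ℤ) - i) * u k) ≤
        w * η * blockNorm L u := by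
  have h := blockNorm_sub_le (u := u) hα
  have h2 : (fun i : ℕ => ∑ k ∈ Finset.range L, (w * bandCoeff M b ((k : ℤ) - i)) * u k) =
      fun i : ℕ => (w : ℂ) * ∑ k ∈ Finset.range L, bandCoeff M b ((k : ℤ) - i) * u k := by
    funext i
    rw [Finset.mul_sum]
    exact Finset.sum_congr rfl fun _ _ => by ring
  rw [h2] at h
  refine h.trans (mul_le_mul_of_nonneg_right ?_ (blockNorm_nonneg _))
  nlinarith

/-- The surviving modes have `|b| ≤ t / w - η`. By Parseval the Laurent part contributes at most `(t
- w η) ‖u‖`, and the model error at most `w η ‖u‖`. -/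
lemma blockNorm_le_of_blockDFT (hL : 0 < L) (hw : 0 < w) (hδ : δ * L ≤ η)
    (hα : ∀ i < L, ∀ k < L, ‖α i k - w * bandCoeff M b ((k : ℤ) - i)‖ ≤ δ * w)
    (hu : ∀ i < L, (i < M ∨ L ≤ i + M) → u i = 0)
    (hp : ∀ p < L, t < w * (‖bandSymbol M b (blockFreq L p)‖ + η) → blockDFT L u p = 0) :
    blockNorm L (fun i => ∑ k ∈ Finset.range L, α i k * u k) ≤ t * blockNorm L u := by
  have hL' : (0 : ℝ) < L := by exact_mod_cast hL
  have hN := blockNorm_nonneg (L := L) u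
  have h1 := blockNorm_sub_laurent_le (u := u) hw.le hδ hα
  have h2 := blockNorm_le_add (L := L) (fun i => ∑ k ∈ Finset.range L, α i k * u k)
    (fun i => (w : ℂ) * ∑ k ∈ Finset.range L, bandCoeff M b ((k : ℤ) - i) * u k)
  rw [blockNorm_smul hw.le] at h2
  have h3 := blockNorm_laurent_sq (b := b) hu
  have h4 := sum_norm_blockDFT_sq (L := L) u
  set V := blockNorm L (fun i => ∑ k ∈ Finset.range L, bandCoeff M b ((k : ℤ) - i) * u k) with hV
  have hV0 : 0 ≤ V := blockNorm_nonneg _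
  -- If no mode survives, `t / w - η` may be negative, but then `u = 0` on the block.
  by_cases hall : ∀ p < L, blockDFT L u p = 0
  · have h5 : V = 0 := by
      rw [Finset.sum_eq_zero (fun p hp' => by rw [hall p (Finset.mem_range.1 hp')]; simp)] at h3
      simpa [hL'.ne'] using h3
    have h6 : blockNorm L u = 0 := by
      rw [Finset.sum_eq_zero (fun p hp' => by rw [hall p (Finset.mem_range.1 hp')]; simp)] at h4
      simpa [hL'.ne'] using h4.symm
    rw [h5] at h2
    rw [h6] at h1 ⊢
    linarith
  · push Not at hall
    obtain ⟨q, hq, hq0⟩ := hall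
    have hb : ∀ p < L, blockDFT L u p ≠ 0 → ‖bandSymbol M b (blockFreq L p)‖ ≤ t / w - η := by
      intro p hpL hp0
      have : w * (‖bandSymbol M b (blockFreq L p)‖ + η) ≤ t := by
        by_contra! h
        exact hp0 (hp p hpL h)
      rw [le_sub_iff_add_le, le_div_iff₀ hw]
      linarith
    have hs : 0 ≤ t / w - η := (norm_nonneg _).trans (hb q hq hq0)
    have h5 : V ≤ (t / w - η) * blockNorm L u := by
      refine le_of_sq_le_sq ?_ (by positivity)
      refine le_of_mul_le_mul_left ?_ hL'
      calc L * V ^ 2 ≤ (t / w - η) ^ 2 * ∑ p ∈ Finset.range L, ‖blockDFT L u p‖ ^ 2 := by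
            rw [h3, Finset.mul_sum]
            refine Finset.sum_le_sum fun p hp' => ?_
            by_cases h0 : blockDFT L u p = 0
            · simp [h0]
            · have := hb p (Finset.mem_range.1 hp') h0
              gcongr
        _ = _ := by rw [h4]; ring
    calc _ ≤ w * V + w * η * blockNorm L u := h2.trans (by linarith)
      _ ≤ w * ((t / w - η) * blockNorm L u) + w * η * blockNorm L u := by gcongr
      _ = t * blockNorm L u := by field_simp; ring

lemma le_blockNorm_of_blockDFT (hL : 0 < L) (hw : 0 < w) (ht : 0 ≤ t) (hη : 0 ≤ η) (hδ : δ * L ≤ η)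
    (hα : ∀ i < L, ∀ k < L, ‖α i k - w * bandCoeff M b ((k : ℤ) - i)‖ ≤ δ * w)
    (hu : ∀ i < L, (i < M ∨ L ≤ i + M) → u i = 0)
    (hp : ∀ p < L, w * (‖bandSymbol M b (blockFreq L p)‖ - η) < t → blockDFT L u p = 0) :
    t * blockNorm L u ≤ blockNorm L (fun i => ∑ k ∈ Finset.range L, α i k * u k) := by
  have hL' : (0 : ℝ) < L := by exact_mod_cast hL
  have hN := blockNorm_nonneg (L := L) u
  have h1 := blockNorm_sub_laurent_le (u := u) hw.le hδ hα
  have h2 := blockNorm_le_add (L := L)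
    (fun i => (w : ℂ) * ∑ k ∈ Finset.range L, bandCoeff M b ((k : ℤ) - i) * u k)
    (fun i => ∑ k ∈ Finset.range L, α i k * u k)
  rw [blockNorm_smul hw.le, blockNorm_sub_comm] at h2
  have h3 := blockNorm_laurent_sq (b := b) hu
  have h4 := sum_norm_blockDFT_sq (L := L) u
  set V := blockNorm L (fun i => ∑ k ∈ Finset.range L, bandCoeff M b ((k : ℤ) - i) * u k) with hV
  have hV0 : 0 ≤ V := blockNorm_nonneg _
  have h5 : (t / w + η) * blockNorm L u ≤ V := by
    refine le_of_sq_le_sq ?_ hV0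
    refine le_of_mul_le_mul_left ?_ hL'
    calc L * ((t / w + η) * blockNorm L u) ^ 2
        = (t / w + η) ^ 2 * ∑ p ∈ Finset.range L, ‖blockDFT L u p‖ ^ 2 := by rw [h4]; ring
      _ ≤ _ := by
        rw [h3, Finset.mul_sum]
        refine Finset.sum_le_sum fun p hp' => ?_
        by_cases h0 : blockDFT L u p = 0
        · simp [h0]
        · have : t / w + η ≤ ‖bandSymbol M b (blockFreq L p)‖ := by
            have : t ≤ w * (‖bandSymbol M b (blockFreq L p)‖ - η) := by
              by_contra! h
              exact h0 (hp p (Finset.mem_range.1 hp') h)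
            rw [← le_sub_iff_add_le, div_le_iff₀ hw]
            linarith
          gcongr
  calc t * blockNorm L u = w * ((t / w + η) * blockNorm L u) - w * η * blockNorm L u := by
        field_simp; ring
    _ ≤ w * V - w * η * blockNorm L u := by gcongr
    _ ≤ _ := by linarith

end BlockFourier

/-! ### Assembling the blocks into bounds for `s_n` -/

section BlockConstraints

/-- The indices below `L r₀` and the indices within `M` of an end of one of the first `R + 1` blocks
of length `L`. -/
def boundarySet (M L r₀ R : ℕ) : Finset ℕ :=
  Finset.range (L * r₀) ∪ (Finset.range (R + 1) ×ˢ (Finset.range M ∪ Finset.Ico (L - M) L)).image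
    fun q => L * q.1 + q.2

lemma card_boundarySet_le (M L r₀ R : ℕ) :
    (boundarySet M L r₀ R).card ≤ L * r₀ + (R + 1) * (2 * M) := by
  refine (Finset.card_union_le _ _).trans (add_le_add (Finset.card_range _).le ?_)
  refine Finset.card_image_le.trans ?_
  rw [Finset.card_product, Finset.card_range]
  refine Nat.mul_le_mul_left _ ((Finset.card_union_le _ _).trans ?_)
  rw [Finset.card_range, Nat.card_Ico]
  omega

/-- The functionals evaluating the coordinates in `S` and the block Fourier coefficients in `P`. -/
noncomputable def constraintMap (L : ℕ) (S : Finset ℕ) (P : Finset (ℕ × ℕ)) :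
    SeqHilbert →ₗ[ℂ] (S ⊕ P → ℂ) :=
  LinearMap.pi (Sum.elim
    (fun j => lp.evalₗ (𝕜 := ℂ) (fun _ : ℕ => ℂ) 2 (j : ℕ))
    (fun q => ∑ i ∈ Finset.range L,
      Complex.exp (-(i * (blockFreq L q.1.2 : ℂ) * Complex.I)) •
        lp.evalₗ (𝕜 := ℂ) (fun _ : ℕ => ℂ) 2 (L * q.1.1 + i)))

lemma constraintMap_eq_zero {L : ℕ} {S : Finset ℕ} {P : Finset (ℕ × ℕ)} {x : SeqHilbert}
    (h : constraintMap L S P x = 0) :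
    (∀ j ∈ S, x j = 0) ∧ ∀ q ∈ P, blockDFT L (fun i => x (L * q.1 + i)) q.2 = 0 := by
  constructor
  · intro j hj
    exact congrFun h (Sum.inl ⟨j, hj⟩)
  · intro q hq
    have := congrFun h (Sum.inr ⟨q, hq⟩)
    simp only [constraintMap, LinearMap.pi_apply, Sum.elim_inr, LinearMap.sum_apply,
      LinearMap.smul_apply, lp.evalₗ_apply, smul_eq_mul, Pi.zero_apply] at this
    rw [← this, blockDFT]
    exact Finset.sum_congr rfl fun _ _ => mul_comm _ _

lemma card_constraint (S : Finset ℕ) (P : Finset (ℕ × ℕ)) :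
    Fintype.card (S ⊕ P) = S.card + P.card := by
  simp

lemma sum_range_mul_eq (f : ℕ → ℝ) (L R : ℕ) :
    ∑ j ∈ Finset.range (L * R), f j =
      ∑ r ∈ Finset.range R, ∑ i ∈ Finset.range L, f (L * r + i) := by
  induction R with
  | zero => simp
  | succ R ih => rw [Nat.mul_succ, Finset.sum_range_add, ih, Finset.sum_range_succ]

variable {M L r₀ R : ℕ} {a : ℕ → ℕ → ℂ}

lemma eq_zero_of_boundary {x : ℕ → ℂ} (hx : ∀ j ∈ boundarySet M L r₀ R, x j = 0) {r i : ℕ}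
    (hr : r ≤ R) (hi : i < L) (h : i < M ∨ L ≤ i + M) : x (L * r + i) = 0 := by
  refine hx _ (Finset.mem_union_right _ (Finset.mem_image.2 ⟨(r, i), ?_, rfl⟩))
  simp only [Finset.mem_product, Finset.mem_range, Finset.mem_union, Finset.mem_Ico]
  omega

/-- Entries leaving block `r` meet coordinates within `M` of an end of a neighbouring block, where
`x` vanishes. The right neighbour of block `R - 1` is block `R`, hence the `R + 1` blocks in
`boundarySet`. -/
lemma bandRow_eq_block_sum (hband : ∀ j k : ℕ, (M : ℤ) < |(k : ℤ) - (j : ℤ)| → a j k = 0)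
    (hML : M ≤ L) {x : ℕ → ℂ} (hx : ∀ j ∈ boundarySet M L r₀ R, x j = 0) {r i : ℕ}
    (hr : r < R) (hi : i < L) :
    bandRow M a x (L * r + i) =
      ∑ k ∈ Finset.range L, a (L * r + i) (L * r + k) * x (L * r + k) := by
  have h1 : ∑ k ∈ Finset.range L, a (L * r + i) (L * r + k) * x (L * r + k) =
      ∑ k ∈ Finset.Ico (L * r) (L * r + L), a (L * r + i) k * x k := by
    rw [Finset.sum_Ico_eq_sum_range]
    simp
  rw [h1, bandRow]
  rw [Finset.sum_subset (Finset.subset_union_left (s₂ := Finset.Ico (L * r) (L * r + L))),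
    ← Finset.sum_subset (Finset.subset_union_right (s₁ := Finset.Icc (L * r + i - M) (L * r + i + M)))]
  · intro k hk1 hk2
    have hx0 : x k = 0 := by
      simp only [Finset.mem_union, Finset.mem_Icc, Finset.mem_Ico] at hk1 hk2
      rcases lt_or_ge k (L * r) with h | h
      · obtain ⟨r', rfl⟩ : ∃ r', r = r' + 1 := by
          refine ⟨r - 1, ?_⟩
          rcases Nat.eq_zero_or_pos r with rfl | h'
          · simp at h
          · omega
        rw [Nat.mul_succ] at *
        obtain ⟨i', rfl⟩ : ∃ i', k = L * r' + i' := ⟨k - L * r', by omega⟩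
        exact eq_zero_of_boundary hx (by omega) (by omega) (by omega)
      · obtain ⟨i', rfl⟩ : ∃ i', k = L * (r + 1) + i' :=
          ⟨k - L * (r + 1), by rw [Nat.mul_succ]; omega⟩
        rw [Nat.mul_succ] at hk1 hk2
        exact eq_zero_of_boundary hx (by omega) (by omega) (by omega)
    rw [hx0, mul_zero]
  · intro k hk1 hk2
    rw [hband, zero_mul]
    rw [Finset.mem_Icc] at hk2
    rw [lt_abs]
    omega

variable {b : ℤ → ℂ} {A : SeqHilbert →L[ℂ] SeqHilbert} {w : ℕ → ℝ} {δ η t : ℝ}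

/-- The block Fourier modes on which the model operator may exceed `t`. -/
noncomputable def largeModes (M L R : ℕ) (b : ℤ → ℂ) (w : ℕ → ℝ) (η t : ℝ) : Finset (ℕ × ℕ) :=
  (Finset.range R ×ˢ Finset.range L).filter fun q =>
    t < w q.1 * (‖bandSymbol M b (blockFreq L q.2)‖ + η)

/-- The block Fourier modes on which the model operator may be below `t`. -/
noncomputable def smallModes (M L R : ℕ) (b : ℤ → ℂ) (w : ℕ → ℝ) (η t : ℝ) : Finset (ℕ × ℕ) :=
  (Finset.range R ×ˢ Finset.range L).filter fun q =>
    w q.1 * (‖bandSymbol M b (blockFreq L q.2)‖ - η) < t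

lemma block_eq_zero {x : ℕ → ℂ} (hx : ∀ j ∈ boundarySet M L r₀ R, x j = 0) {r : ℕ} (hr : r < r₀)
    {i : ℕ} (hi : i < L) : x (L * r + i) = 0 := by
  refine hx _ (Finset.mem_union_left _ (Finset.mem_range.2 ?_))
  calc L * r + i < L * r + L := by omega
    _ = L * (r + 1) := by ring
    _ ≤ L * r₀ := Nat.mul_le_mul_left _ hr

lemma blockNorm_row_le (hL : 0 < L) (hML : M ≤ L)
    (hband : ∀ j k : ℕ, (M : ℤ) < |(k : ℤ) - (j : ℤ)| → a j k = 0)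
    (hw : ∀ r, r₀ ≤ r → 0 < w r) (hδ : δ * L ≤ η)
    (hmodel : ∀ r, r₀ ≤ r → ∀ i < L, ∀ k < L,
      ‖a (L * r + i) (L * r + k) - w r * bandCoeff M b ((k : ℤ) - i)‖ ≤ δ * w r)
    {x : ℕ → ℂ} (hx : ∀ j ∈ boundarySet M L r₀ R, x j = 0)
    (hp : ∀ q ∈ largeModes M L R b w η t, blockDFT L (fun i => x (L * q.1 + i)) q.2 = 0)
    {r : ℕ} (hr : r < R) :
    ∑ i ∈ Finset.range L, ‖bandRow M a x (L * r + i)‖ ^ 2 ≤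
      t ^ 2 * ∑ i ∈ Finset.range L, ‖x (L * r + i)‖ ^ 2 := by
  have hrow : ∑ i ∈ Finset.range L, ‖bandRow M a x (L * r + i)‖ ^ 2 =
      blockNorm L (fun i => ∑ k ∈ Finset.range L, a (L * r + i) (L * r + k) * x (L * r + k)) ^ 2 := by
    rw [blockNorm_sq]
    exact Finset.sum_congr rfl fun i hi => by
      rw [bandRow_eq_block_sum hband hML hx hr (Finset.mem_range.1 hi)]
  rw [hrow, ← blockNorm_sq (L := L) fun i => x (L * r + i), ← mul_pow]
  rcases lt_or_ge r r₀ with h | h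
  · have h0 : blockNorm L (fun i => ∑ k ∈ Finset.range L,
        a (L * r + i) (L * r + k) * x (L * r + k)) ^ 2 = 0 := by
      rw [blockNorm_sq]
      refine Finset.sum_eq_zero fun i _ => ?_
      rw [Finset.sum_eq_zero fun k hk => by
        rw [block_eq_zero hx h (Finset.mem_range.1 hk), mul_zero]]
      simp
    rw [h0]
    positivity
  · refine pow_le_pow_left₀ (blockNorm_nonneg _) ?_ 2
    refine blockNorm_le_of_blockDFT (u := fun i => x (L * r + i)) hL (hw r h) hδ (hmodel r h)
      (fun i hi hb => eq_zero_of_boundary hx hr.le hi hb) fun p hpL hlt => ?_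
    refine hp (r, p) ?_
    simp only [largeModes, Finset.mem_filter, Finset.mem_product, Finset.mem_range]
    exact ⟨⟨hr, hpL⟩, hlt⟩

lemma le_blockNorm_row (hL : 0 < L) (hML : M ≤ L)
    (hband : ∀ j k : ℕ, (M : ℤ) < |(k : ℤ) - (j : ℤ)| → a j k = 0) (ht : 0 ≤ t)
    (hw : ∀ r, r₀ ≤ r → 0 < w r) (hη : 0 ≤ η) (hδ : δ * L ≤ η)
    (hmodel : ∀ r, r₀ ≤ r → ∀ i < L, ∀ k < L,
      ‖a (L * r + i) (L * r + k) - w r * bandCoeff M b ((k : ℤ) - i)‖ ≤ δ * w r)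
    {x : ℕ → ℂ} (hx : ∀ j ∈ boundarySet M L r₀ R, x j = 0)
    (hp : ∀ q ∈ smallModes M L R b w η t, blockDFT L (fun i => x (L * q.1 + i)) q.2 = 0)
    {r : ℕ} (hr : r < R) :
    t ^ 2 * ∑ i ∈ Finset.range L, ‖x (L * r + i)‖ ^ 2 ≤
      ∑ i ∈ Finset.range L, ‖bandRow M a x (L * r + i)‖ ^ 2 := by
  rcases lt_or_ge r r₀ with h | h
  · rw [Finset.sum_eq_zero fun i hi => by
      rw [block_eq_zero hx h (Finset.mem_range.1 hi), norm_zero, zero_pow two_ne_zero], mul_zero]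
    positivity
  have hrow : ∑ i ∈ Finset.range L, ‖bandRow M a x (L * r + i)‖ ^ 2 =
      blockNorm L (fun i => ∑ k ∈ Finset.range L, a (L * r + i) (L * r + k) * x (L * r + k)) ^ 2 := by
    rw [blockNorm_sq]
    exact Finset.sum_congr rfl fun i hi => by
      rw [bandRow_eq_block_sum hband hML hx hr (Finset.mem_range.1 hi)]
  rw [hrow, ← blockNorm_sq (L := L) fun i => x (L * r + i), ← mul_pow]
  refine pow_le_pow_left₀ (mul_nonneg ht (blockNorm_nonneg _)) ?_ 2
  refine le_blockNorm_of_blockDFT (u := fun i => x (L * r + i)) hL (hw r h) ht hη hδ (hmodel r h)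
    (fun i hi hb => eq_zero_of_boundary hx hr.le hi hb) fun p hpL hlt => ?_
  refine hp (r, p) ?_
  simp only [smallModes, Finset.mem_filter, Finset.mem_product, Finset.mem_range]
  exact ⟨⟨hr, hpL⟩, hlt⟩

/-- The rows below `L * R` contribute at most `t² ‖x‖²`, block by block, and the later rows at most
`(c (2 M + 1))² ‖x‖²`. -/
lemma singularValue_le_of_card (hA : HasMatrix A a) (hL : 0 < L) (hML : M ≤ L)
    (hband : ∀ j k : ℕ, (M : ℤ) < |(k : ℤ) - (j : ℤ)| → a j k = 0)
    (hw : ∀ r, r₀ ≤ r → 0 < w r) (hδ : δ * L ≤ η)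
    (hmodel : ∀ r, r₀ ≤ r → ∀ i < L, ∀ k < L,
      ‖a (L * r + i) (L * r + k) - w r * bandCoeff M b ((k : ℤ) - i)‖ ≤ δ * w r)
    {c T : ℝ} (hc : ∀ j k, L * R ≤ j → ‖a j k‖ ≤ c) (hT : 0 ≤ T)
    (hTc : t ^ 2 + (c * (2 * M + 1)) ^ 2 ≤ T ^ 2) {n : ℕ}
    (hn : (boundarySet M L r₀ R).card + (largeModes M L R b w η t).card ≤ n) :
    singularValue A n ≤ T := by
  refine singularValue_le_of_ker A
    (constraintMap L (boundarySet M L r₀ R) (largeModes M L R b w η t)) hT (fun x hx => ?_)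
    (by rwa [card_constraint])
  obtain ⟨hx1, hx2⟩ := constraintMap_eq_zero hx
  refine le_of_sq_le_sq ?_ (by positivity)
  refine (hA.norm_apply_sq_le hband hc x).trans ?_
  have h1 : ∑ j ∈ Finset.range (L * R), ‖A x j‖ ^ 2 ≤ t ^ 2 * ‖x‖ ^ 2 := by
    calc ∑ j ∈ Finset.range (L * R), ‖A x j‖ ^ 2
        ≤ t ^ 2 * ∑ j ∈ Finset.range (L * R), ‖x j‖ ^ 2 := by
          simp only [hA.apply_eq_bandRow hband]
          rw [sum_range_mul_eq, sum_range_mul_eq, Finset.mul_sum]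
          exact Finset.sum_le_sum fun r hr =>
            blockNorm_row_le hL hML hband hw hδ hmodel hx1 hx2 (Finset.mem_range.1 hr)
      _ ≤ t ^ 2 * ‖x‖ ^ 2 := by gcongr; exact seqHilbert_sum_norm_sq_le x _
  calc _ ≤ t ^ 2 * ‖x‖ ^ 2 + (c * (2 * M + 1) * ‖x‖) ^ 2 := by gcongr
    _ = (t ^ 2 + (c * (2 * M + 1)) ^ 2) * ‖x‖ ^ 2 := by ring
    _ ≤ T ^ 2 * ‖x‖ ^ 2 := by gcongr
    _ = _ := by ring

/-- The embedding of `ℂ^N` into `ℓ²` as the sequences supported in `{0, …, N - 1}`. -/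
noncomputable def initialEmbedding (N : ℕ) : (Fin N → ℂ) →ₗ[ℂ] SeqHilbert :=
  ∑ i : Fin N, (lp.lsingle (𝕜 := ℂ) (E := fun _ : ℕ => ℂ) 2 (i : ℕ)).comp (LinearMap.proj i)

lemma initialEmbedding_apply (N : ℕ) (c : Fin N → ℂ) (j : ℕ) :
    initialEmbedding N c j = if h : j < N then c ⟨j, h⟩ else 0 := by
  have h1 : initialEmbedding N c = ∑ i : Fin N, (lp.single 2 (i : ℕ) (c i) : SeqHilbert) := by
    simp only [initialEmbedding, LinearMap.sum_apply]
    rfl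
  rw [h1, lp.coeFn_sum, Finset.sum_apply]
  simp only [lp.coeFn_single, Pi.single_apply]
  split_ifs with h
  · rw [Finset.sum_eq_single ⟨j, h⟩]
    · simp
    · intro i _ hi
      rw [if_neg]
      rintro rfl
      exact hi rfl
    · simp
  · refine Finset.sum_eq_zero fun i _ => if_neg ?_
    rintro rfl
    exact h i.2

lemma initialEmbedding_injective (N : ℕ) : Function.Injective (initialEmbedding N) := by
  intro c d h
  funext i
  have := congrArg (fun x : SeqHilbert => x (i : ℕ)) h
  simpa [initialEmbedding_apply] using this

/-- The test vectors are supported in the first `R` blocks, a space of dimension `L * R`; dropping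
the later rows of `A x` only decreases the norm. -/
lemma le_singularValue_of_card (hA : HasMatrix A a) (hcomp : IsCompactOperator A) (hL : 0 < L)
    (hML : M ≤ L)
    (hband : ∀ j k : ℕ, (M : ℤ) < |(k : ℤ) - (j : ℤ)| → a j k = 0) (ht : 0 ≤ t)
    (hw : ∀ r, r₀ ≤ r → 0 < w r) (hη : 0 ≤ η) (hδ : δ * L ≤ η)
    (hmodel : ∀ r, r₀ ≤ r → ∀ i < L, ∀ k < L,
      ‖a (L * r + i) (L * r + k) - w r * bandCoeff M b ((k : ℤ) - i)‖ ≤ δ * w r) {n : ℕ}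
    (hn : n + ((boundarySet M L r₀ R).card + (smallModes M L R b w η t).card) < L * R) :
    t ≤ singularValue A n := by
  refine le_singularValue_of_ker A hcomp (initialEmbedding (L * R))
    (initialEmbedding_injective _)
    (constraintMap L (boundarySet M L r₀ R) (smallModes M L R b w η t)) (fun c hc => ?_)
    (by rwa [card_constraint])
  set x := initialEmbedding (L * R) c with hxdef
  obtain ⟨hx1, hx2⟩ := constraintMap_eq_zero hc
  refine le_of_sq_le_sq ?_ (norm_nonneg _)
  have hsupp : ‖x‖ ^ 2 = ∑ j ∈ Finset.range (L * R), ‖x j‖ ^ 2 := by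
    rw [seqHilbert_norm_sq_eq_tsum]
    refine tsum_eq_sum fun j hj => ?_
    rw [hxdef, initialEmbedding_apply, dif_neg (by simpa using hj)]
    simp
  calc (t * ‖x‖) ^ 2 = t ^ 2 * ∑ j ∈ Finset.range (L * R), ‖x j‖ ^ 2 := by rw [mul_pow, hsupp]
    _ ≤ ∑ j ∈ Finset.range (L * R), ‖A x j‖ ^ 2 := by
        simp only [hA.apply_eq_bandRow hband]
        rw [sum_range_mul_eq, sum_range_mul_eq, Finset.mul_sum]
        exact Finset.sum_le_sum fun r hr =>
          le_blockNorm_row hL hML hband ht hw hη hδ hmodel hx1 hx2 (Finset.mem_range.1 hr)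
    _ ≤ ‖A x‖ ^ 2 := seqHilbert_sum_norm_sq_le _ _

end BlockConstraints

/-! ### Counting the modes -/

section Counting

variable {M L R : ℕ} {b : ℤ → ℂ} {γ τ σ η : ℝ}

/-- The normalised counting density `(max(|b(e^{iθ})| + σ, 0) / τ)^{1/γ}`. -/
noncomputable def modeDensity (M : ℕ) (b : ℤ → ℂ) (γ τ σ θ : ℝ) : ℝ :=
  (max (‖bandSymbol M b θ‖ + σ) 0 / τ) ^ (1 / γ)

lemma modeDensity_nonneg (hτ : 0 < τ) (θ : ℝ) : 0 ≤ modeDensity M b γ τ σ θ := by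
  unfold modeDensity; positivity

/-- Solves the threshold inequality for the position `x`; the truncation `max β 0` makes both sides
fail when `β` is negative. -/
lemma le_rpow_neg_mul_iff (hγ : 0 < γ) (hτ : 0 < τ) {n x β : ℝ} (hn : 0 < n) (hx : 0 < x) :
    τ * n ^ (-γ) ≤ x ^ (-γ) * β ↔ x ≤ (max β 0 / τ) ^ (1 / γ) * n := by
  have hnγ : 0 < n ^ γ := Real.rpow_pos_of_pos hn γ
  have hxγ : 0 < x ^ γ := Real.rpow_pos_of_pos hx γ
  rw [← div_le_iff₀ hn, one_div, Real.le_rpow_inv_iff_of_pos (by positivity) (by positivity) hγ,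
    Real.div_rpow hx.le hn.le, Real.rpow_neg hn.le, Real.rpow_neg hx.le]
  have h1 : τ * (n ^ γ)⁻¹ ≤ (x ^ γ)⁻¹ * β ↔ x ^ γ / n ^ γ ≤ β / τ := by
    rw [div_le_div_iff₀ hnγ hτ, ← div_eq_mul_inv, ← div_eq_inv_mul, div_le_div_iff₀ hnγ hxγ]
    constructor <;> intro h <;> linarith
  rw [h1]
  rcases le_total 0 β with h | h
  · rw [max_eq_left h]
  · rw [max_eq_right h, zero_div]
    have h2 : 0 < x ^ γ / n ^ γ := by positivity
    have h3 : β / τ ≤ 0 := div_nonpos_of_nonpos_of_nonneg h hτ.le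
    constructor <;> intro h <;> linarith

/-- The sizes of the model blocks. -/
noncomputable def blockWeight (γ : ℝ) (L r : ℕ) : ℝ := ((L * r : ℕ) : ℝ) ^ (-γ)

lemma blockWeight_pos (hL : 0 < L) {r : ℕ} (hr : 1 ≤ r) : 0 < blockWeight γ L r := by
  refine Real.rpow_pos_of_pos ?_ _
  have : 0 < L * r := Nat.mul_pos hL hr
  exact_mod_cast this

lemma le_blockWeight_mul_iff (hγ : 0 < γ) (hτ : 0 < τ) (hL : 0 < L) {n r : ℕ} (hn : 1 ≤ n)
    (hr : 1 ≤ r) (θ : ℝ) :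
    τ * (n : ℝ) ^ (-γ) ≤ blockWeight γ L r * (‖bandSymbol M b θ‖ + σ) ↔
      (r : ℝ) ≤ modeDensity M b γ τ σ θ * n / L := by
  have hn' : (0 : ℝ) < n := by exact_mod_cast hn
  have hL' : (0 : ℝ) < L := by exact_mod_cast hL
  have hr' : (0 : ℝ) < r := by exact_mod_cast hr
  rw [blockWeight, Nat.cast_mul, le_rpow_neg_mul_iff hγ hτ hn' (by positivity), modeDensity,
    le_div_iff₀ hL', mul_comm (r : ℝ)]

lemma card_filter_product_eq_sum (R L : ℕ) (p : ℕ × ℕ → Prop) [DecidablePred p] :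
    ((Finset.range R ×ˢ Finset.range L).filter p).card =
      ∑ q ∈ Finset.range L, ((Finset.range R).filter fun r => p (r, q)).card := by
  rw [Finset.card_filter, Finset.sum_product_right]
  exact Finset.sum_congr rfl fun q _ => (Finset.card_filter _ _).symm

/-- For fixed `p` the admissible `r ≥ 1` form an initial segment. The rounding error, including `r =
0` where the power law is meaningless, is at most 1 per frequency, so `L` in all. -/
lemma card_largeModes_le (hγ : 0 < γ) (hτ : 0 < τ) (hL : 0 < L) {n : ℕ} (hn : 1 ≤ n) :
    ((largeModes M L R b (blockWeight γ L) σ (τ * (n : ℝ) ^ (-γ))).card : ℝ) ≤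
      n * ((∑ p ∈ Finset.range L, modeDensity M b γ τ σ (blockFreq L p)) / L) + L := by
  rw [largeModes, card_filter_product_eq_sum, Nat.cast_sum]
  have h : ∀ p ∈ Finset.range L, (((Finset.range R).filter fun r => τ * (n : ℝ) ^ (-γ) <
      blockWeight γ L r * (‖bandSymbol M b (blockFreq L p)‖ + σ)).card : ℝ) ≤
      modeDensity M b γ τ σ (blockFreq L p) * n / L + 1 := by
    intro p _
    have h0 : 0 ≤ modeDensity M b γ τ σ (blockFreq L p) * n / L := by
      have := modeDensity_nonneg (M := M) (b := b) (γ := γ) (σ := σ) hτ (blockFreq L p)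
      positivity
    have h1 : ((Finset.range R).filter fun r => τ * (n : ℝ) ^ (-γ) <
        blockWeight γ L r * (‖bandSymbol M b (blockFreq L p)‖ + σ)) ⊆
        Finset.range (⌊modeDensity M b γ τ σ (blockFreq L p) * n / L⌋₊ + 1) := by
      intro r hr
      rw [Finset.mem_filter] at hr
      rw [Finset.mem_range, Nat.lt_succ_iff]
      rcases Nat.eq_zero_or_pos r with rfl | hr1
      · exact Nat.zero_le _
      · exact Nat.le_floor ((le_blockWeight_mul_iff hγ hτ hL hn hr1 _).1 hr.2.le)
    have h2 := Finset.card_le_card h1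
    rw [Finset.card_range] at h2
    have h3 := Nat.floor_le h0
    have h4 : (((Finset.range R).filter fun r => τ * (n : ℝ) ^ (-γ) <
        blockWeight γ L r * (‖bandSymbol M b (blockFreq L p)‖ + σ)).card : ℝ) ≤
        (⌊modeDensity M b γ τ σ (blockFreq L p) * n / L⌋₊ : ℝ) + 1 := by exact_mod_cast h2
    linarith
  refine (Finset.sum_le_sum h).trans (le_of_eq ?_)
  rw [Finset.sum_add_distrib, ← Finset.sum_div, ← Finset.sum_mul]
  simp
  ring

lemma card_smallModes_le (hγ : 0 < γ) (hτ : 0 < τ) (hL : 0 < L) {n : ℕ} (hn : 1 ≤ n)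
    (hR : ∀ p < L, modeDensity M b γ τ (-η) (blockFreq L p) * n / L ≤ R) :
    ((smallModes M L R b (blockWeight γ L) η (τ * (n : ℝ) ^ (-γ))).card : ℝ) ≤
      L + L * R - n * ((∑ p ∈ Finset.range L, modeDensity M b γ τ (-η) (blockFreq L p)) / L) := by
  rw [smallModes, card_filter_product_eq_sum, Nat.cast_sum]
  have h : ∀ p ∈ Finset.range L, (((Finset.range R).filter fun r =>
      blockWeight γ L r * (‖bandSymbol M b (blockFreq L p)‖ - η) < τ * (n : ℝ) ^ (-γ)).card : ℝ) ≤
      1 + R - modeDensity M b γ τ (-η) (blockFreq L p) * n / L := by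
    intro p hp
    set y := modeDensity M b γ τ (-η) (blockFreq L p) * n / L with hy
    have h1 : ((Finset.range R).filter fun r =>
        blockWeight γ L r * (‖bandSymbol M b (blockFreq L p)‖ - η) < τ * (n : ℝ) ^ (-γ)) ⊆
        insert 0 (Finset.Ico ⌈y⌉₊ R) := by
      intro r hr
      rw [Finset.mem_filter, Finset.mem_range, sub_eq_add_neg] at hr
      rw [Finset.mem_insert, Finset.mem_Ico]
      rcases Nat.eq_zero_or_pos r with rfl | hr1
      · exact Or.inl rfl
      · refine Or.inr ⟨Nat.ceil_le.2 ?_, hr.1⟩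
        by_contra! hlt
        exact absurd ((le_blockWeight_mul_iff hγ hτ hL hn hr1 _).2 hlt.le) (not_le.2 hr.2)
    have h2 := (Finset.card_le_card h1).trans (Finset.card_insert_le _ _)
    rw [Nat.card_Ico] at h2
    -- Here `hR` is needed: it keeps the natural subtraction `R - ⌈y⌉₊` from truncating.
    have h3 : ⌈y⌉₊ ≤ R := Nat.ceil_le.2 (hR p (Finset.mem_range.1 hp))
    have h4 : (((Finset.range R).filter fun r =>
        blockWeight γ L r * (‖bandSymbol M b (blockFreq L p)‖ - η) < τ * (n : ℝ) ^ (-γ)).card : ℝ) ≤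
        (R : ℝ) - (⌈y⌉₊ : ℝ) + 1 := by
      rw [← Nat.cast_sub h3]
      exact_mod_cast h2
    have h5 := Nat.le_ceil y
    linarith
  refine (Finset.sum_le_sum h).trans (le_of_eq ?_)
  rw [Finset.sum_sub_distrib, ← Finset.sum_div, ← Finset.sum_mul]
  simp
  ring

end Counting

/-! ### Riemann sums over the discrete frequencies -/

section RiemannSums

lemma tendsto_riemann_sum {g : ℝ → ℝ} (hg : Continuous g) :
    Tendsto (fun L : ℕ => (∑ p ∈ Finset.range L, g (p / L)) / L) atTop
      (nhds (∫ x in (0 : ℝ)..1, g x)) := by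
  rw [Metric.tendsto_atTop]
  intro ε hε
  have huc := isCompact_Icc.uniformContinuousOn_of_continuous
    (hg.continuousOn (s := Set.Icc (0 : ℝ) 1))
  rw [Metric.uniformContinuousOn_iff] at huc
  obtain ⟨d, hd, hgd⟩ := huc (ε / 2) (half_pos hε)
  obtain ⟨N, hN⟩ := exists_nat_gt (1 / d)
  refine ⟨N + 1, fun L hL => ?_⟩
  have hL0 : (0 : ℝ) < L := by
    have : 0 < L := by omega
    exact_mod_cast this
  have hLd : 1 / (L : ℝ) < d := by
    rw [div_lt_iff₀ hL0]
    rw [div_lt_iff₀ hd] at hN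
    have : (N : ℝ) ≤ L := by exact_mod_cast (by omega : N ≤ L)
    nlinarith
  have hint : ∀ x y : ℝ, IntervalIntegrable g MeasureTheory.volume x y :=
    fun x y => hg.intervalIntegrable x y
  have hsplit : ∫ x in (0 : ℝ)..1, g x =
      ∑ p ∈ Finset.range L, ∫ x in ((p : ℝ) / L)..(((p + 1 : ℕ) : ℝ) / L), g x := by
    rw [intervalIntegral.sum_integral_adjacent_intervals (a := fun p : ℕ => (p : ℝ) / L)
      fun k _ => hint _ _]
    simp [hL0.ne']
  have hconst : (∑ p ∈ Finset.range L, g (p / L)) / L =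
      ∑ p ∈ Finset.range L, ∫ _ in ((p : ℝ) / L)..(((p + 1 : ℕ) : ℝ) / L), g (p / L) := by
    rw [Finset.sum_div]
    refine Finset.sum_congr rfl fun p _ => ?_
    rw [intervalIntegral.integral_const, smul_eq_mul]
    push_cast
    ring
  rw [Real.dist_eq, hsplit, hconst, ← Finset.sum_sub_distrib]
  refine lt_of_le_of_lt (Finset.abs_sum_le_sum_abs _ _) ?_
  have hterm : ∀ p ∈ Finset.range L, |(∫ _ in ((p : ℝ) / L)..(((p + 1 : ℕ) : ℝ) / L), g (p / L)) -
      ∫ x in ((p : ℝ) / L)..(((p + 1 : ℕ) : ℝ) / L), g x| ≤ ε / 2 * (1 / L) := by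
    intro p hp
    rw [← intervalIntegral.integral_sub intervalIntegrable_const (hint _ _), ← Real.norm_eq_abs]
    have hle : (p : ℝ) / L ≤ ((p + 1 : ℕ) : ℝ) / L := by gcongr; simp
    have hp1 : ((p + 1 : ℕ) : ℝ) / L ≤ 1 := by
      rw [div_le_one hL0]
      exact_mod_cast Finset.mem_range.1 hp
    have hp0 : 0 ≤ (p : ℝ) / L := by positivity
    have hlen : ((p + 1 : ℕ) : ℝ) / L - (p : ℝ) / L = 1 / L := by push_cast; ring
    have := intervalIntegral.norm_integral_le_of_norm_le_const (a := (p : ℝ) / L)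
      (b := ((p + 1 : ℕ) : ℝ) / L) (C := ε / 2) (f := fun x => g (p / L) - g x) fun x hx => by
        rw [Set.uIoc_of_le hle] at hx
        rw [← dist_eq_norm]
        refine (hgd _ ⟨hp0, hle.trans hp1⟩ _ ⟨hp0.trans hx.1.le, hx.2.trans hp1⟩ ?_).le
        rw [Real.dist_eq, abs_sub_comm, abs_of_nonneg (by linarith [hx.1])]
        linarith [hx.2]
    rwa [hlen, abs_of_nonneg (by positivity)] at this
  refine lt_of_le_of_lt (Finset.sum_le_sum hterm) ?_
  rw [Finset.sum_const, Finset.card_range, nsmul_eq_mul]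
  field_simp
  linarith

lemma tendsto_blockFreq_mean {f : ℝ → ℝ} (hf : Continuous f)
    (hper : Function.Periodic f (2 * Real.pi)) :
    Tendsto (fun L : ℕ => (∑ p ∈ Finset.range L, f (blockFreq L p)) / L) atTop
      (nhds ((∫ θ in (-Real.pi)..Real.pi, f θ) / (2 * Real.pi))) := by
  have h1 := tendsto_riemann_sum (g := fun x => f (2 * Real.pi * x)) (by fun_prop)
  have h2 : ∫ x in (0 : ℝ)..1, f (2 * Real.pi * x) =
      (∫ θ in (-Real.pi)..Real.pi, f θ) / (2 * Real.pi) := by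
    rw [intervalIntegral.integral_comp_mul_left f Real.two_pi_pos.ne']
    have h3 := hper.intervalIntegral_add_eq 0 (-Real.pi)
    rw [zero_add, show -Real.pi + 2 * Real.pi = Real.pi by ring] at h3
    rw [mul_zero, mul_one, h3, smul_eq_mul]
    ring
  rw [h2] at h1
  refine h1.congr fun L => ?_
  congr 1
  refine Finset.sum_congr rfl fun p _ => ?_
  rw [blockFreq]
  congr 1
  ring

end RiemannSums

/-! ### The limiting density and the leading coefficient -/

section DensityLimits

variable {M : ℕ} {b : ℤ → ℂ} {γ τ : ℝ}

lemma continuous_bandSymbol (M : ℕ) (b : ℤ → ℂ) : Continuous (bandSymbol M b) := by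
  unfold bandSymbol
  fun_prop

lemma bandSymbol_periodic (M : ℕ) (b : ℤ → ℂ) :
    Function.Periodic (bandSymbol M b) (2 * Real.pi) := by
  intro θ
  unfold bandSymbol
  refine Finset.sum_congr rfl fun k _ => ?_
  congr 1
  rw [Complex.exp_eq_exp_iff_exists_int]
  exact ⟨k, by push_cast; ring⟩

lemma continuous_uncurry_modeDensity (hγ : 0 < γ) (M : ℕ) (b : ℤ → ℂ) (τ : ℝ) :
    Continuous (Function.uncurry fun σ θ => modeDensity M b γ τ σ θ) := by
  unfold modeDensity Function.uncurry
  have := continuous_bandSymbol M b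
  refine Continuous.rpow_const (by fun_prop) fun _ => Or.inr (by positivity)

/-- The mean of the counting density. -/
noncomputable def meanDensity (M : ℕ) (b : ℤ → ℂ) (γ τ σ : ℝ) : ℝ :=
  (∫ θ in (-Real.pi)..Real.pi, modeDensity M b γ τ σ θ) / (2 * Real.pi)

lemma tendsto_sum_modeDensity (hγ : 0 < γ) (σ : ℝ) :
    Tendsto (fun L : ℕ => (∑ p ∈ Finset.range L, modeDensity M b γ τ σ (blockFreq L p)) / L) atTop
      (nhds (meanDensity M b γ τ σ)) := by
  refine tendsto_blockFreq_mean ?_ fun θ => ?_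
  · exact (continuous_uncurry_modeDensity hγ M b τ).uncurry_left σ
  · rw [modeDensity, bandSymbol_periodic, modeDensity]

lemma continuous_meanDensity (hγ : 0 < γ) : Continuous (meanDensity M b γ τ) := by
  unfold meanDensity
  exact (intervalIntegral.continuous_parametric_intervalIntegral_of_continuous'
    (continuous_uncurry_modeDensity hγ M b τ) _ _).div_const _

/-- The coefficient of the leading term. -/
noncomputable def leadingCoeff (M : ℕ) (b : ℤ → ℂ) (γ : ℝ) : ℝ :=
  (∫ θ in (-Real.pi)..Real.pi, ‖bandSymbol M b θ‖ ^ (1 / γ) / (2 * Real.pi)) ^ γ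

lemma leadingCoeff_integral_nonneg (M : ℕ) (b : ℤ → ℂ) (γ : ℝ) :
    0 ≤ ∫ θ in (-Real.pi)..Real.pi, ‖bandSymbol M b θ‖ ^ (1 / γ) / (2 * Real.pi) :=
  intervalIntegral.integral_nonneg (by linarith [Real.pi_pos]) fun θ _ => by positivity

lemma leadingCoeff_nonneg (M : ℕ) (b : ℤ → ℂ) (γ : ℝ) : 0 ≤ leadingCoeff M b γ :=
  Real.rpow_nonneg (leadingCoeff_integral_nonneg M b γ) _

/-- The density is homogeneous in `τ`, so the critical value at which the mean equals 1 is `τ = C`,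
when `C > 0`. -/
lemma meanDensity_zero (hγ : 0 < γ) (hτ : 0 < τ) :
    meanDensity M b γ τ 0 = (leadingCoeff M b γ / τ) ^ (1 / γ) := by
  have hI := leadingCoeff_integral_nonneg M b γ
  rw [Real.div_rpow (leadingCoeff_nonneg M b γ) hτ.le, leadingCoeff, ← Real.rpow_mul hI,
    mul_one_div_cancel hγ.ne', Real.rpow_one, meanDensity, ← intervalIntegral.integral_div,
    ← intervalIntegral.integral_div]
  congr 1
  funext θ
  rw [modeDensity, add_zero, max_eq_left (norm_nonneg _), Real.div_rpow (norm_nonneg _) hτ.le]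
  ring

lemma meanDensity_zero_lt_one (hγ : 0 < γ) (hτ : 0 < τ) (h : leadingCoeff M b γ < τ) :
    meanDensity M b γ τ 0 < 1 := by
  rw [meanDensity_zero hγ hτ]
  exact Real.rpow_lt_one (div_nonneg (leadingCoeff_nonneg M b γ) hτ.le)
    ((div_lt_one hτ).2 h) (by positivity)

lemma one_lt_meanDensity_zero (hγ : 0 < γ) (hτ : 0 < τ) (h : τ < leadingCoeff M b γ) :
    1 < meanDensity M b γ τ 0 := by
  rw [meanDensity_zero hγ hτ]
  exact Real.one_lt_rpow ((one_lt_div hτ).2 h) (by positivity)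

end DensityLimits

/-! ### Matrix estimates and choice of parameters -/

section BandedAsymptotics

variable {γ : ℝ} {M : ℕ} {b : ℤ → ℂ} {a : ℕ → ℕ → ℂ}

/-- Only finitely many diagonals are involved, so one `J` serves them all; off the band both terms
vanish. -/
lemma exists_norm_sub_bandCoeff_le
    (hband : ∀ j k : ℕ, (M : ℤ) < |(k : ℤ) - (j : ℤ)| → a j k = 0)
    (hdiag : ∀ m : ℤ, |m| ≤ (M : ℤ) →
      (fun j : ℕ => a j ((j : ℤ) + m).toNat - b m * (((j : ℝ) ^ (-γ) : ℝ) : ℂ))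
        =o[atTop] (fun j : ℕ => (j : ℝ) ^ (-γ))) {δ : ℝ} (hδ : 0 < δ) :
    ∃ J : ℕ, ∀ j k : ℕ, J ≤ j →
      ‖a j k - bandCoeff M b ((k : ℤ) - j) * (((j : ℝ) ^ (-γ) : ℝ) : ℂ)‖ ≤ δ * (j : ℝ) ^ (-γ) := by
  have h1 : ∀ᶠ j : ℕ in atTop, ∀ m ∈ Finset.Icc (-(M : ℤ)) M,
      ‖a j ((j : ℤ) + m).toNat - b m * (((j : ℝ) ^ (-γ) : ℝ) : ℂ)‖ ≤ δ * ‖(j : ℝ) ^ (-γ)‖ := by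
    rw [eventually_all_finset]
    intro m hm
    exact (hdiag m (abs_le.2 (Finset.mem_Icc.1 hm))).bound hδ
  obtain ⟨J, hJ⟩ := eventually_atTop.1 h1
  refine ⟨J, fun j k hj => ?_⟩
  have hpos : 0 ≤ (j : ℝ) ^ (-γ) := Real.rpow_nonneg (Nat.cast_nonneg j) _
  by_cases h : |(k : ℤ) - j| ≤ (M : ℤ)
  · have h2 := hJ j hj ((k : ℤ) - j) (Finset.mem_Icc.2 (abs_le.1 h))
    rw [Real.norm_of_nonneg hpos, add_sub_cancel, Int.toNat_natCast] at h2
    rwa [bandCoeff, if_pos h]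
  · rw [bandCoeff, if_neg h, hband j k (not_le.1 h)]
    simp only [zero_mul, sub_zero, norm_zero]
    positivity

lemma norm_bandCoeff_le (M : ℕ) (b : ℤ → ℂ) (m : ℤ) :
    ‖bandCoeff M b m‖ ≤ ∑ k ∈ Finset.Icc (-(M : ℤ)) M, ‖b k‖ := by
  rw [bandCoeff]
  split_ifs with h
  · exact Finset.single_le_sum (f := fun k => ‖b k‖) (fun _ _ => norm_nonneg _)
      (Finset.mem_Icc.2 (abs_le.1 h))
  · rw [norm_zero]
    exact Finset.sum_nonneg fun _ _ => norm_nonneg _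

lemma norm_bandSymbol_le (M : ℕ) (b : ℤ → ℂ) (θ : ℝ) :
    ‖bandSymbol M b θ‖ ≤ ∑ k ∈ Finset.Icc (-(M : ℤ)) M, ‖b k‖ := by
  refine (norm_sum_le _ _).trans (Finset.sum_le_sum fun k _ => ?_)
  rw [norm_mul, show (k : ℂ) * (θ : ℂ) * Complex.I = ((k * θ : ℝ) : ℂ) * Complex.I by push_cast; ring,
    Complex.norm_exp_ofReal_mul_I, mul_one]

lemma exists_norm_entry_le
    (hband : ∀ j k : ℕ, (M : ℤ) < |(k : ℤ) - (j : ℤ)| → a j k = 0)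
    (hdiag : ∀ m : ℤ, |m| ≤ (M : ℤ) →
      (fun j : ℕ => a j ((j : ℤ) + m).toNat - b m * (((j : ℝ) ^ (-γ) : ℝ) : ℂ))
        =o[atTop] (fun j : ℕ => (j : ℝ) ^ (-γ))) :
    ∃ K : ℝ, 0 < K ∧ ∃ J : ℕ, ∀ j k : ℕ, J ≤ j → ‖a j k‖ ≤ K * (j : ℝ) ^ (-γ) := by
  obtain ⟨J, hJ⟩ := exists_norm_sub_bandCoeff_le hband hdiag one_pos
  have hB : 0 ≤ ∑ k ∈ Finset.Icc (-(M : ℤ)) M, ‖b k‖ := Finset.sum_nonneg fun _ _ => norm_nonneg _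
  refine ⟨1 + ∑ k ∈ Finset.Icc (-(M : ℤ)) M, ‖b k‖, by positivity, J, fun j k hj => ?_⟩
  have hpos : 0 ≤ (j : ℝ) ^ (-γ) := Real.rpow_nonneg (Nat.cast_nonneg j) _
  have h1 := norm_le_norm_add_norm_sub' (a j k)
    (bandCoeff M b ((k : ℤ) - j) * (((j : ℝ) ^ (-γ) : ℝ) : ℂ))
  have h2 := hJ j k hj
  rw [norm_mul, Complex.norm_real, Real.norm_of_nonneg hpos] at h1
  have h3 := mul_le_mul_of_nonneg_right (norm_bandCoeff_le M b ((k : ℤ) - j)) hpos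
  linarith

lemma tendsto_const_mul_natCast_rpow_neg (hγ : 0 < γ) (K : ℝ) :
    Tendsto (fun j : ℕ => K * (j : ℝ) ^ (-γ)) atTop (nhds 0) := by
  simpa using ((tendsto_rpow_neg_atTop hγ).comp tendsto_natCast_atTop_atTop).const_mul K

lemma exists_forall_norm_entry_le_of_pos (hγ : 0 < γ)
    (hband : ∀ j k : ℕ, (M : ℤ) < |(k : ℤ) - (j : ℤ)| → a j k = 0)
    (hdiag : ∀ m : ℤ, |m| ≤ (M : ℤ) →
      (fun j : ℕ => a j ((j : ℤ) + m).toNat - b m * (((j : ℝ) ^ (-γ) : ℝ) : ℂ))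
        =o[atTop] (fun j : ℕ => (j : ℝ) ^ (-γ))) {c : ℝ} (hc : 0 < c) :
    ∃ N : ℕ, ∀ j k, N ≤ j → ‖a j k‖ ≤ c := by
  obtain ⟨K, -, J, hJ⟩ := exists_norm_entry_le hband hdiag
  obtain ⟨N, hN⟩ := eventually_atTop.1
    ((tendsto_const_mul_natCast_rpow_neg hγ K).eventually_le_const hc)
  exact ⟨max J N, fun j k hj => (hJ j k (le_of_max_le_left hj)).trans (hN j (le_of_max_le_right hj))⟩

lemma exists_forall_norm_entry_le (hγ : 0 < γ)
    (hband : ∀ j k : ℕ, (M : ℤ) < |(k : ℤ) - (j : ℤ)| → a j k = 0)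
    (hdiag : ∀ m : ℤ, |m| ≤ (M : ℤ) →
      (fun j : ℕ => a j ((j : ℤ) + m).toNat - b m * (((j : ℝ) ^ (-γ) : ℝ) : ℂ))
        =o[atTop] (fun j : ℕ => (j : ℝ) ^ (-γ))) :
    ∃ c : ℝ, ∀ j k, ‖a j k‖ ≤ c := by
  obtain ⟨N, hN⟩ := exists_forall_norm_entry_le_of_pos hγ hband hdiag one_pos
  set S : ℝ := ∑ j ∈ Finset.range N, ∑ k ∈ Finset.range (N + M), ‖a j k‖ with hS
  have hS0 : 0 ≤ S := Finset.sum_nonneg fun _ _ => Finset.sum_nonneg fun _ _ => norm_nonneg _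
  refine ⟨1 + S, fun j k => ?_⟩
  rcases le_or_gt N j with h | h
  · linarith [hN j k h]
  by_cases hk : k < N + M
  · have h1 : ‖a j k‖ ≤ ∑ k ∈ Finset.range (N + M), ‖a j k‖ :=
      Finset.single_le_sum (f := fun k => ‖a j k‖) (fun _ _ => norm_nonneg _) (Finset.mem_range.2 hk)
    have h2 : ∑ k ∈ Finset.range (N + M), ‖a j k‖ ≤ S :=
      Finset.single_le_sum (f := fun j => ∑ k ∈ Finset.range (N + M), ‖a j k‖)
        (fun _ _ => Finset.sum_nonneg fun _ _ => norm_nonneg _) (Finset.mem_range.2 h)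
    linarith
  · rw [hband j k (by rw [lt_abs]; omega), norm_zero]
    positivity

/-- Within a block the ratio of positions is `1 + i / (L r)`, with `i / (L r) < 1 / r`, so its power
is uniformly close to 1. -/
lemma exists_abs_rpow_sub_blockWeight_le (γ : ℝ) {L : ℕ} (hL : 0 < L) {δ : ℝ}
    (hδ : 0 < δ) : ∃ r₀ : ℕ, 1 ≤ r₀ ∧ ∀ r, r₀ ≤ r → ∀ i < L,
      |((L * r + i : ℕ) : ℝ) ^ (-γ) - blockWeight γ L r| ≤ δ * blockWeight γ L r := by
  have h1 : ContinuousAt (fun x : ℝ => x ^ (-γ)) 1 :=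
    Real.continuousAt_rpow_const _ _ (Or.inl one_ne_zero)
  rw [Metric.continuousAt_iff] at h1
  obtain ⟨ε, hε, hεδ⟩ := h1 δ hδ
  obtain ⟨N, hN⟩ := exists_nat_gt (1 / ε)
  refine ⟨N + 1, by omega, fun r hr i hi => ?_⟩
  have hr0 : (0 : ℝ) < r := by
    have : 0 < r := by omega
    exact_mod_cast this
  have hL0 : (0 : ℝ) < L := by exact_mod_cast hL
  have hx : dist (1 + (i : ℝ) / (L * r)) 1 < ε := by
    rw [Real.dist_eq, add_sub_cancel_left, abs_of_nonneg (by positivity), div_lt_iff₀ (by positivity)]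
    rw [div_lt_iff₀ hε] at hN
    have h2 : (N : ℝ) ≤ r := by exact_mod_cast (by omega : N ≤ r)
    have h3 : (i : ℝ) < L := by exact_mod_cast hi
    have h4 : 1 < r * ε := hN.trans_le (by gcongr)
    nlinarith
  have h5 := hεδ hx
  rw [Real.dist_eq, Real.one_rpow] at h5
  have h6 : ((L * r + i : ℕ) : ℝ) ^ (-γ) =
      (1 + (i : ℝ) / (L * r)) ^ (-γ) * blockWeight γ L r := by
    rw [blockWeight, ← Real.mul_rpow (by positivity) (by positivity)]
    congr 1
    push_cast
    field_simp
  rw [h6, ← sub_one_mul, abs_mul, abs_of_pos (blockWeight_pos hL (by omega : 1 ≤ r))]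
  exact mul_le_mul_of_nonneg_right h5.le (blockWeight_pos hL (by omega : 1 ≤ r)).le

lemma exists_norm_sub_blockWeight_mul_le
    (hband : ∀ j k : ℕ, (M : ℤ) < |(k : ℤ) - (j : ℤ)| → a j k = 0)
    (hdiag : ∀ m : ℤ, |m| ≤ (M : ℤ) →
      (fun j : ℕ => a j ((j : ℤ) + m).toNat - b m * (((j : ℝ) ^ (-γ) : ℝ) : ℂ))
        =o[atTop] (fun j : ℕ => (j : ℝ) ^ (-γ))) {L : ℕ} (hL : 0 < L) {δ : ℝ} (hδ : 0 < δ) :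
    ∃ r₀ : ℕ, 1 ≤ r₀ ∧ ∀ r, r₀ ≤ r → ∀ i < L, ∀ k < L,
      ‖a (L * r + i) (L * r + k) - blockWeight γ L r * bandCoeff M b ((k : ℤ) - i)‖ ≤
        δ * blockWeight γ L r := by
  set B : ℝ := ∑ k ∈ Finset.Icc (-(M : ℤ)) M, ‖b k‖ with hB
  have hB0 : 0 ≤ B := Finset.sum_nonneg fun _ _ => norm_nonneg _
  -- Half of `δ` goes to the entries (`δ / 4`, doubled since `z` is at most twice the block weight),
  -- half to freezing the weight; `B + 1` avoids dividing by zero.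
  obtain ⟨J, hJ⟩ := exists_norm_sub_bandCoeff_le hband hdiag (show 0 < δ / 4 by positivity)
  obtain ⟨r₁, hr₁, hw⟩ := exists_abs_rpow_sub_blockWeight_le γ hL
    (show 0 < min 1 (δ / (2 * (B + 1))) by positivity)
  refine ⟨max r₁ J, le_max_of_le_left hr₁, fun r hr i hi k hk => ?_⟩
  have hw0 : 0 < blockWeight γ L r := blockWeight_pos hL (hr₁.trans (le_of_max_le_left hr))
  have h1 := hw r (le_of_max_le_left hr) i hi
  have hJr : J ≤ L * r + i :=
    (le_of_max_le_right hr).trans ((Nat.le_mul_of_pos_left r hL).trans (Nat.le_add_right _ _))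
  have h2 := hJ (L * r + i) (L * r + k) hJr
  have h3 : ((L * r + k : ℕ) : ℤ) - ((L * r + i : ℕ) : ℤ) = (k : ℤ) - i := by push_cast; ring
  rw [h3] at h2
  set β := bandCoeff M b ((k : ℤ) - i) with hβ
  have hβB : ‖β‖ ≤ B := norm_bandCoeff_le M b _
  set z : ℝ := ((L * r + i : ℕ) : ℝ) ^ (-γ) with hz
  have h4 : z ≤ 2 * blockWeight γ L r := by
    have h5 : min 1 (δ / (2 * (B + 1))) * blockWeight γ L r ≤ 1 * blockWeight γ L r := by
      gcongr; exact min_le_left _ _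
    linarith [(abs_le.1 h1).2]
  have h6 : ‖β * (z : ℂ) - blockWeight γ L r * β‖ ≤ δ / 2 * blockWeight γ L r := by
    rw [mul_comm β, ← sub_mul, norm_mul, ← Complex.ofReal_sub, Complex.norm_real, Real.norm_eq_abs]
    calc |z - blockWeight γ L r| * ‖β‖
        ≤ (δ / (2 * (B + 1)) * blockWeight γ L r) * (B + 1) := by
          refine mul_le_mul (h1.trans ?_) (by linarith) (norm_nonneg _) (by positivity)
          gcongr
          exact min_le_right _ _
      _ = _ := by field_simp
  calc _ ≤ ‖a (L * r + i) (L * r + k) - β * (z : ℂ)‖ + ‖β * (z : ℂ) - blockWeight γ L r * β‖ :=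
        norm_sub_le_norm_sub_add_norm_sub _ _ _
    _ ≤ δ / 4 * (2 * blockWeight γ L r) + δ / 2 * blockWeight γ L r := by
        refine add_le_add (h2.trans ?_) h6
        gcongr
    _ = _ := by ring

variable {A : SeqHilbert →L[ℂ] SeqHilbert}

lemma natCeil_mul_div_bounds {Q : ℝ} (hQ : 0 ≤ Q) {L : ℕ} (hL : 0 < L) (n : ℕ) :
    Q * n ≤ L * (⌈Q * n / L⌉₊ : ℝ) ∧ (⌈Q * n / L⌉₊ : ℝ) ≤ n * (Q / L) + 1 := by
  have hL0 : (0 : ℝ) < L := by exact_mod_cast hL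
  constructor
  · rw [mul_comm (L : ℝ), ← div_le_iff₀ hL0]
    exact Nat.le_ceil _
  · have := (Nat.ceil_lt_add_one (show 0 ≤ Q * n / L by positivity)).le
    refine this.trans (le_of_eq ?_)
    ring

lemma eventually_lt_natCast_mul {κ : ℝ} (c : ℝ) (hκ : 0 < κ) : ∀ᶠ n : ℕ in atTop, c < n * κ :=
  (tendsto_natCast_atTop_atTop.atTop_mul_const hκ).eventually_gt_atTop c

lemma eventually_singularValue_le (hγ : 0 < γ) (hA : HasMatrix A a)
    (hband : ∀ j k : ℕ, (M : ℤ) < |(k : ℤ) - (j : ℤ)| → a j k = 0)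
    (hdiag : ∀ m : ℤ, |m| ≤ (M : ℤ) →
      (fun j : ℕ => a j ((j : ℤ) + m).toNat - b m * (((j : ℝ) ^ (-γ) : ℝ) : ℂ))
        =o[atTop] (fun j : ℕ => (j : ℝ) ^ (-γ))) {T : ℝ} (hT : leadingCoeff M b γ < T) :
    ∀ᶠ n : ℕ in atTop, singularValue A n ≤ T * (n : ℝ) ^ (-γ) := by
  have hC := leadingCoeff_nonneg M b γ
  obtain ⟨τ, hτC, hτT⟩ := exists_between hT
  have hτ : 0 < τ := hC.trans_lt hτC
  have hT0 : 0 < T := hτ.trans hτT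
  obtain ⟨K, hK, J, hKJ⟩ := exists_norm_entry_le hband hdiag
  have hd2 : 0 < T ^ 2 - τ ^ 2 := sub_pos.2 (pow_lt_pow_left₀ hτT hτ.le two_ne_zero)
  set d := √(T ^ 2 - τ ^ 2) with hd
  have hd0 : 0 < d := Real.sqrt_pos.2 hd2
  -- With this `Q` the rows beyond `Q n` contribute at most `d² n^(-2γ)`, exactly the gap `T² - τ²`.
  obtain ⟨Q, hQ, hQd⟩ : ∃ Q : ℝ, 0 < Q ∧ K * Q ^ (-γ) * (2 * M + 1) ≤ d := by
    have h1 : Tendsto (fun Q : ℝ => K * Q ^ (-γ) * (2 * M + 1)) atTop (nhds 0) := by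
      simpa using ((tendsto_rpow_neg_atTop hγ).const_mul K).mul_const (2 * (M : ℝ) + 1)
    obtain ⟨Q, hQ1, hQ2⟩ := ((h1.eventually_le_const hd0).and (eventually_gt_atTop 0)).exists
    exact ⟨Q, hQ2, hQ1⟩
  obtain ⟨η, hη, hηI⟩ : ∃ η : ℝ, 0 < η ∧ meanDensity M b γ τ η < 1 := by
    have h1 := (continuous_meanDensity (M := M) (b := b) (τ := τ) hγ).continuousAt.eventually_lt_const
      (meanDensity_zero_lt_one hγ hτ hτC)
    obtain ⟨η, h2, h3⟩ := ((h1.filter_mono nhdsWithin_le_nhds).and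
      (self_mem_nhdsWithin : Set.Ioi (0 : ℝ) ∈ nhdsWithin 0 (Set.Ioi 0))).exists
    exact ⟨η, h3, h2⟩
  obtain ⟨L, hLlim, hML, hL⟩ : ∃ L : ℕ,
      (∑ p ∈ Finset.range L, modeDensity M b γ τ η (blockFreq L p)) / L + 2 * M * Q / L < 1 ∧
        M ≤ L ∧ 0 < L := by
    have h1 := (tendsto_sum_modeDensity (M := M) (b := b) (τ := τ) hγ η).add
      (tendsto_const_div_atTop_nhds_zero_nat (2 * (M : ℝ) * Q))
    rw [add_zero] at h1
    obtain ⟨L, h2, h3, h4⟩ := ((h1.eventually_lt_const hηI).and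
      ((eventually_ge_atTop M).and (eventually_gt_atTop 0))).exists
    exact ⟨L, h2, h3, h4⟩
  have hL0 : (0 : ℝ) < L := by exact_mod_cast hL
  obtain ⟨r₀, hr₀, hmodel⟩ := exists_norm_sub_blockWeight_mul_le hband hdiag hL
    (show 0 < η / L by positivity)
  set F := (∑ p ∈ Finset.range L, modeDensity M b γ τ η (blockFreq L p)) / L with hF
  -- The fixed costs: `L r₀` initial coordinates, `4 M` from rounding `R` up and from the extra
  -- boundary block, `L` from rounding in the mode count.
  filter_upwards [eventually_lt_natCast_mul (L * r₀ + 4 * M + L) (sub_pos.2 hLlim),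
    eventually_lt_natCast_mul (J : ℝ) hQ, eventually_ge_atTop 1] with n hn hnJ hn1
  have hn0 : (0 : ℝ) < n := by exact_mod_cast hn1
  have hnγ : 0 < (n : ℝ) ^ (-γ) := Real.rpow_pos_of_pos hn0 _
  obtain ⟨hR1, hR2⟩ := natCeil_mul_div_bounds hQ.le hL n
  set R := ⌈Q * n / L⌉₊ with hR
  refine singularValue_le_of_card (r₀ := r₀) (R := R) (w := blockWeight γ L) (δ := η / L) (η := η)
    (t := τ * (n : ℝ) ^ (-γ)) (c := K * (Q * n) ^ (-γ)) hA hL hML hband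
    (fun r hr => blockWeight_pos hL (hr₀.trans hr)) (le_of_eq (by field_simp)) hmodel ?_
    (by positivity) ?_ ?_
  · intro j k hj
    have hj' : Q * n ≤ j := hR1.trans (by exact_mod_cast hj)
    have hJj : J ≤ j := by
      have : (J : ℝ) ≤ j := by linarith
      exact_mod_cast this
    refine (hKJ j k hJj).trans (mul_le_mul_of_nonneg_left ?_ hK.le)
    exact Real.rpow_le_rpow_of_nonpos (by positivity) hj' (by linarith)
  · rw [Real.mul_rpow hQ.le hn0.le]
    have h1 : (K * (Q ^ (-γ) * (n : ℝ) ^ (-γ)) * (2 * M + 1)) ^ 2 ≤ (d * (n : ℝ) ^ (-γ)) ^ 2 := by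
      refine pow_le_pow_left₀ (by positivity) ?_ 2
      calc _ = (K * Q ^ (-γ) * (2 * M + 1)) * (n : ℝ) ^ (-γ) := by ring
        _ ≤ _ := by gcongr
    calc _ ≤ (τ * (n : ℝ) ^ (-γ)) ^ 2 + (d * (n : ℝ) ^ (-γ)) ^ 2 := by gcongr
      _ = (τ ^ 2 + d ^ 2) * ((n : ℝ) ^ (-γ)) ^ 2 := by ring
      _ = (T * (n : ℝ) ^ (-γ)) ^ 2 := by rw [hd, Real.sq_sqrt hd2.le]; ring
  · have h1 : ((boundarySet M L r₀ R).card : ℝ) ≤ L * r₀ + (R + 1) * (2 * M) := by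
      exact_mod_cast card_boundarySet_le M L r₀ R
    have h2 := card_largeModes_le (M := M) (b := b) (R := R) (σ := η) hγ hτ hL hn1
    rw [← hF] at h2
    have h3 : (R : ℝ) * (2 * M) ≤ (n * (Q / L) + 1) * (2 * M) := by gcongr
    have h4 : (n : ℝ) * (1 - (F + 2 * M * Q / L)) =
        n - n * F - n * (Q / L) * (2 * M) := by ring
    rw [h4] at hn
    have h5 : ((boundarySet M L r₀ R).card : ℝ) +
        ((largeModes M L R b (blockWeight γ L) η (τ * (n : ℝ) ^ (-γ))).card : ℝ) ≤ n := by
      linarith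
    exact_mod_cast h5

lemma eventually_le_singularValue (hγ : 0 < γ) (hA : HasMatrix A a) (hcomp : IsCompactOperator A)
    (hband : ∀ j k : ℕ, (M : ℤ) < |(k : ℤ) - (j : ℤ)| → a j k = 0)
    (hdiag : ∀ m : ℤ, |m| ≤ (M : ℤ) →
      (fun j : ℕ => a j ((j : ℤ) + m).toNat - b m * (((j : ℝ) ^ (-γ) : ℝ) : ℂ))
        =o[atTop] (fun j : ℕ => (j : ℝ) ^ (-γ))) {τ : ℝ} (hτ : 0 < τ)
    (hτC : τ < leadingCoeff M b γ) :
    ∀ᶠ n : ℕ in atTop, τ * (n : ℝ) ^ (-γ) ≤ singularValue A n := by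
  set B : ℝ := ∑ k ∈ Finset.Icc (-(M : ℤ)) M, ‖b k‖ with hB
  have hB0 : 0 ≤ B := Finset.sum_nonneg fun _ _ => norm_nonneg _
  -- Since `B` bounds the symbol, `Q` bounds the density: every mode above the threshold lies within
  -- the first `Q n` positions.
  set Q : ℝ := (B / τ) ^ (1 / γ) with hQdef
  have hQ : 0 ≤ Q := by positivity
  obtain ⟨η, hη, hηI⟩ : ∃ η : ℝ, 0 < η ∧ 1 < meanDensity M b γ τ (-η) := by
    have h0 : Continuous fun η : ℝ => meanDensity M b γ τ (-η) :=
      (continuous_meanDensity hγ).comp continuous_neg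
    have h1 := (h0.continuousAt (x := 0)).eventually_const_lt (u := 1)
      (by simp only [neg_zero]; exact one_lt_meanDensity_zero hγ hτ hτC)
    obtain ⟨η, h2, h3⟩ := ((h1.filter_mono nhdsWithin_le_nhds).and
      (self_mem_nhdsWithin : Set.Ioi (0 : ℝ) ∈ nhdsWithin 0 (Set.Ioi 0))).exists
    exact ⟨η, h3, h2⟩
  obtain ⟨L, hLlim, hML, hL⟩ : ∃ L : ℕ,
      1 < (∑ p ∈ Finset.range L, modeDensity M b γ τ (-η) (blockFreq L p)) / L - 2 * M * Q / L ∧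
        M ≤ L ∧ 0 < L := by
    have h1 := (tendsto_sum_modeDensity (M := M) (b := b) (τ := τ) hγ (-η)).sub
      (tendsto_const_div_atTop_nhds_zero_nat (2 * (M : ℝ) * Q))
    rw [sub_zero] at h1
    obtain ⟨L, h2, h3, h4⟩ := ((h1.eventually_const_lt hηI).and
      ((eventually_ge_atTop M).and (eventually_gt_atTop 0))).exists
    exact ⟨L, h2, h3, h4⟩
  have hL0 : (0 : ℝ) < L := by exact_mod_cast hL
  obtain ⟨r₀, hr₀, hmodel⟩ := exists_norm_sub_blockWeight_mul_le hband hdiag hL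
    (show 0 < η / L by positivity)
  set F := (∑ p ∈ Finset.range L, modeDensity M b γ τ (-η) (blockFreq L p)) / L with hF
  filter_upwards [eventually_lt_natCast_mul (L * r₀ + 4 * M + L) (sub_pos.2 hLlim),
    eventually_ge_atTop 1] with n hn hn1
  have hn0 : (0 : ℝ) < n := by exact_mod_cast hn1
  obtain ⟨hR1, hR2⟩ := natCeil_mul_div_bounds hQ hL n
  set R := ⌈Q * n / L⌉₊ with hR
  refine le_singularValue_of_card (r₀ := r₀) (R := R) (w := blockWeight γ L) (δ := η / L) (η := η)
    hA hcomp hL hML hband (by positivity)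
    (fun r hr => blockWeight_pos hL (hr₀.trans hr)) hη.le (le_of_eq (by field_simp)) hmodel ?_
  have hdens : ∀ p < L, modeDensity M b γ τ (-η) (blockFreq L p) * n / L ≤ R := by
    intro p _
    refine le_trans ?_ (Nat.le_ceil _)
    have h1 : modeDensity M b γ τ (-η) (blockFreq L p) ≤ Q := by
      unfold modeDensity
      have h2 : max (‖bandSymbol M b (blockFreq L p)‖ + -η) 0 ≤ B :=
        max_le (by linarith [norm_bandSymbol_le M b (blockFreq L p)]) hB0
      rw [hQdef]
      gcongr
    gcongr
  have h1 : ((boundarySet M L r₀ R).card : ℝ) ≤ L * r₀ + (R + 1) * (2 * M) := by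
    exact_mod_cast card_boundarySet_le M L r₀ R
  have h2 := card_smallModes_le (M := M) (b := b) (R := R) (η := η) hγ hτ hL hn1 hdens
  rw [← hF] at h2
  have h3 : (R : ℝ) * (2 * M) ≤ (n * (Q / L) + 1) * (2 * M) := by gcongr
  have h4 : (n : ℝ) * (F - 2 * M * Q / L - 1) = n * F - n * (Q / L) * (2 * M) - n := by ring
  rw [h4] at hn
  have h5 : (n : ℝ) + (((boundarySet M L r₀ R).card : ℝ) +
      ((smallModes M L R b (blockWeight γ L) η (τ * (n : ℝ) ^ (-γ))).card : ℝ)) < L * R := by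
    linarith
  exact_mod_cast h5

end BandedAsymptotics

theorem theorem1p2 (γ : ℝ) (hγ : 0 < γ) (M : ℕ) (b : ℤ → ℂ) (a : ℕ → ℕ → ℂ)
    (hband : ∀ j k : ℕ, (M : ℤ) < |(k : ℤ) - (j : ℤ)| → a j k = 0)
    (hdiag : ∀ m : ℤ, |m| ≤ (M : ℤ) →
      (fun j : ℕ => a j ((j : ℤ) + m).toNat - b m * (((j : ℝ) ^ (-γ) : ℝ) : ℂ))
        =o[atTop] (fun j : ℕ => (j : ℝ) ^ (-γ))) :
    (∃ A : SeqHilbert →L[ℂ] SeqHilbert, HasMatrix A a) ∧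
    ∀ A : SeqHilbert →L[ℂ] SeqHilbert, HasMatrix A a →
      IsCompactOperator A ∧
      (fun n : ℕ => singularValue A n -
          (∫ θ in (-Real.pi)..Real.pi, ‖bandSymbol M b θ‖ ^ (1 / γ) / (2 * Real.pi)) ^ γ
            * (n : ℝ) ^ (-γ))
        =o[atTop] (fun n : ℕ => (n : ℝ) ^ (-γ)) := by
  obtain ⟨c, hc⟩ := exists_forall_norm_entry_le hγ hband hdiag
  refine ⟨exists_hasMatrix_of_banded hband hc, fun A hA => ?_⟩
  have hcomp := hA.isCompactOperator hband fun _ hc =>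
    exists_forall_norm_entry_le_of_pos hγ hband hdiag hc
  refine ⟨hcomp, isLittleO_iff.2 fun ε hε => ?_⟩
  change ∀ᶠ n : ℕ in atTop, ‖singularValue A n - leadingCoeff M b γ * (n : ℝ) ^ (-γ)‖ ≤
    ε * ‖(n : ℝ) ^ (-γ)‖
  have hlow : ∀ᶠ n : ℕ in atTop, (leadingCoeff M b γ - ε) * (n : ℝ) ^ (-γ) ≤ singularValue A n := by
    -- The counting argument needs a positive threshold; otherwise `s_n ≥ 0` suffices, which also
    -- covers a zero symbol.
    rcases le_or_gt (leadingCoeff M b γ - ε) 0 with h | h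
    · refine Eventually.of_forall fun n => le_trans ?_ (singularValue_nonneg A n)
      exact mul_nonpos_of_nonpos_of_nonneg h (Real.rpow_nonneg (Nat.cast_nonneg n) _)
    · exact eventually_le_singularValue hγ hA hcomp hband hdiag h (by linarith)
  filter_upwards [hlow, eventually_singularValue_le hγ hA hband hdiag
    (show leadingCoeff M b γ < leadingCoeff M b γ + ε by linarith)] with n h1 h2
  rw [Real.norm_eq_abs, Real.norm_of_nonneg (Real.rpow_nonneg (Nat.cast_nonneg n) _), abs_le]
  constructor <;> linarith
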